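/- A three counter machine has three counters, each storing a nonnegative integer, and is controlled by a finite sequential program with four types of instructions: increment a counter; conditionally decrement a counter (if its value is positive, subtract $1$ and continue with the next instruction, otherwise leave it unchanged and jump to a specified instruction); unconditional jump; halt. It computes $f:\mathbb N\times\mathbb N\to\mathbb N$ (with $0\in\mathbb N$) in polynomial time if there is a polynomial $p$ such that for all $x,y$ the machine, started at its first instruction with counter contents $x,y,0$, reaches a halt instruction after at most $p(\max(x,y))$ steps with $f(x,y)$ in its first counter. A deterministic one-tape Turing machine, with a finite state set and a finite tape alphabet containing distinct symbols blank, $0$, $1$, $\#$, computes $f$ in linear space if there is a constant $c$ such that for all $x,y$ the machine, started with its head on the blank cell immediately before the first symbol of the word $w=\mathrm{bin}(x)\,\#\,\mathrm{bin}(y)^R$ on an otherwise blank tape, halts with $\mathrm{bin}(f(x,y))$ as its tape contents and its head on the blank cell immediately before the first cell of this word, and during the computation its head stays within distance $c\cdot|w|$ of its initial position. Here $\mathrm{bin}(n)$ is the binary representation of $n$ without leading zeros, most significant bit first ($\mathrm{bin}(0)$ is the empty word), and $u^R$ is the reversal of $u$. **Theorem 1.** The class of functions $f:\mathbb N\times\mathbb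 N\to\mathbb N$ computable by three counter machines in polynomial time coincides with the class of functions $f:\mathbb N\times\mathbb N\to\mathbb N$ computable by deterministic Turing machines in linear space, where input and output of the Turing machines are encoded in binary. -/

import Mathlib

/-! ### Counter machines -/

/-- The four instructions of a `k` counter machine. Instructions are addressed by their position
in the program. -/
inductive CounterInstr (k : ℕ) : Type
  /-- add 1 to counter `i` -/
  | inc (i : Fin k)
  /-- if counter `i` is positive, subtract 1; otherwise leave it unchanged and jump to `target` -/
  | dec (i : Fin k) (target : ℕ)
  | jump (target : ℕ)
  | halt

abbrev CounterProgram (k : ℕ) : Type := List (CounterInstr k)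

structure CounterConfig (k : ℕ) : Type where
  pc : ℕ
  val : Fin k → ℕ

namespace CounterProgram

variable {k : ℕ}

/-- One step. A configuration at a `halt` instruction is left unchanged, and so is one whose
program counter has left the program (the latter does not count as halted, see `Halted`). -/
def step (P : CounterProgram k) (c : CounterConfig k) : CounterConfig k :=
  match P[c.pc]? with
  | some (.inc i) => ⟨c.pc + 1, Function.update c.val i (c.val i + 1)⟩
  | some (.dec i target) =>
      if 0 < c.val i then ⟨c.pc + 1, Function.update c.val i (c.val i - 1)⟩
      else ⟨target, c.val⟩
  | some (.jump target) => ⟨target, c.val⟩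
  | some .halt => c
  | none => c

/-- The machine has stopped: it has reached a `halt` instruction. -/
def Halted (P : CounterProgram k) (c : CounterConfig k) : Prop :=
  P[c.pc]? = some .halt

end CounterProgram

/-- `f` is computable by a three counter machine in polynomial time: started with `x`, `y`, `0` in
its counters, the machine halts with `f x y` in its first counter, after a number of steps that is
polynomially bounded in the larger input value. -/
def ThreeCounterPolyTime (f : ℕ → ℕ → ℕ) : Prop :=
  ∃ (P : CounterProgram 3) (p : Polynomial ℕ), ∀ x y : ℕ, ∃ t : ℕ, t ≤ p.eval (max x y) ∧
    P.Halted (P.step^[t] ⟨0, ![x, y, 0]⟩) ∧ (P.step^[t] ⟨0, ![x, y, 0]⟩).val 0 = f x y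

/-! ### Turing machines -/

/-- The symbols that every tape alphabet contains. -/
inductive BaseSymbol : Type
  | blank
  | zero
  | one
  | sep

/-- Head movements. -/
inductive HeadMove : Type
  | left
  | stay
  | right

def HeadMove.offset : HeadMove → ℤ
  | .left => -1
  | .stay => 0
  | .right => 1

/-- A deterministic Turing machine with one tape, infinite in both directions, with finitely many
states and a finite tape alphabet containing the (distinct) base symbols. It halts when the
transition function is undefined. -/
structure TuringMachine : Type 1 where
  State : Type
  Symbol : Type
  [finiteState : Finite State]
  [finiteSymbol : Finite Symbol]
  base : BaseSymbol ↪ Symbol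
  start : State
  transition : State → Symbol → Option (State × Symbol × HeadMove)

namespace TuringMachine

structure Config (M : TuringMachine) : Type where
  state : M.State
  head : ℤ
  tape : ℤ → M.Symbol

/-- One step; halted configurations are left unchanged. -/
def step (M : TuringMachine) (c : M.Config) : M.Config :=
  match M.transition c.state (c.tape c.head) with
  | some (q, a, d) => ⟨q, c.head + d.offset, Function.update c.tape c.head a⟩
  | none => c

def Halted (M : TuringMachine) (c : M.Config) : Prop :=
  M.transition c.state (c.tape c.head) = none

/-- The tape that carries the word `w` on the cells `h + 1, h + 2, …` and is blank elsewhere, so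
that a head on cell `h` stands immediately before the first symbol of `w`. -/
def tapeOf (M : TuringMachine) (h : ℤ) (w : List BaseSymbol) : ℤ → M.Symbol :=
  fun i => M.base (if h < i then w.getD (i - h - 1).toNat .blank else .blank)

/-- The configuration in which `M` is started on the input word `w`. -/
def init (M : TuringMachine) (w : List BaseSymbol) : M.Config :=
  ⟨M.start, 0, M.tapeOf 0 w⟩

end TuringMachine

/-- The binary representation of `n`, most significant bit first, without leading zeros; the
number `0` has the empty word as its representation. -/
def bin (n : ℕ) : List BaseSymbol :=
  (n.bits.map fun b => if b then BaseSymbol.one else BaseSymbol.zero).reverse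

/-- The input word `bin(x) # bin(y)ᴿ`. -/
def pairInput (x y : ℕ) : List BaseSymbol :=
  bin x ++ BaseSymbol.sep :: (bin y).reverse

/-- `f` is computable by a deterministic Turing machine in linear space: started before the word
`bin(x) # bin(y)ᴿ`, the machine halts with `bin(f(x, y))` as its tape contents and its head before
this word, and its head never gets farther than `c * n` cells from its initial position, where `n`
is the length of the input word and the constant `c` does not depend on the input. -/
def TuringLinearSpace (f : ℕ → ℕ → ℕ) : Prop :=
  ∃ (M : TuringMachine) (c : ℕ), ∀ x y : ℕ,
    (∃ t : ℕ, M.Halted (M.step^[t] (M.init (pairInput x y))) ∧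
      (M.step^[t] (M.init (pairInput x y))).tape =
        M.tapeOf (M.step^[t] (M.init (pairInput x y))).head (bin (f x y))) ∧
    ∀ s : ℕ, |(M.step^[s] (M.init (pairInput x y))).head| ≤ ((c * (pairInput x y).length : ℕ) : ℤ)

/-!
A three counter machine that runs for polynomially many steps has counters of linearly many bits,
and a Turing machine can keep these in binary on three tracks of its tape and update them in place.

Conversely, a tape is a pair of stacks: the cells on either side of the head are the digits of two
numbers in a base `K` at least as large as the alphabet. Pushing a digit is multiplication by `K`
and popping one is division by `K`, and both can be done by moving a counter back and forth into
the third one. In linear space the counters stay below `K ^ O(n)`, which is polynomial in the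
input, and a deterministic computation that halts never repeats a configuration: it takes at most
as many steps as there are configurations with counters of this size.
-/

/-! ### Runs -/

/-- Iterating `f` leads from `a` to `b` without leaving `S`. The set `S` carries the space bounds
of both machine models. -/
def Reaches {α : Type*} (f : α → α) (S : Set α) (a b : α) : Prop :=
  ∃ t, f^[t] a = b ∧ ∀ s ≤ t, f^[s] a ∈ S

namespace Reaches

variable {α β : Type*} {f : α → α} {S : Set α} {a b c : α}

theorem refl (ha : a ∈ S) : Reaches f S a a :=
  ⟨0, rfl, fun s hs => by rwa [Nat.le_zero.1 hs]⟩

theorem head (ha : a ∈ S) (h : Reaches f S (f a) b) : Reaches f S a b := by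
  obtain ⟨t, ht, hS⟩ := h
  refine ⟨t + 1, ht, fun s hs => ?_⟩
  cases s with
  | zero => exact ha
  | succ s => exact hS s (by omega)

theorem single (ha : a ∈ S) (hb : b ∈ S) (h : f a = b) : Reaches f S a b :=
  head ha (h ▸ refl (h ▸ hb))

theorem trans (h₁ : Reaches f S a b) (h₂ : Reaches f S b c) : Reaches f S a c := by
  obtain ⟨t, ht, hS⟩ := h₁
  induction t generalizing a with
  | zero => exact (show a = b from ht) ▸ h₂
  | succ t ih => exact head (hS 0 t.succ.zero_le) (ih ht fun s hs => hS (s + 1) (by omega))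

theorem left_mem (h : Reaches f S a b) : a ∈ S :=
  h.choose_spec.2 0 (Nat.zero_le _)

theorem simulate {g : β → β} {T : Set β} {R : β → α → Prop}
    (hstep : ∀ x ∈ T, g x ∈ T → ∀ y, R x y → ∃ y', R (g x) y' ∧ Reaches f S y y')
    (hmem : ∀ x ∈ T, ∀ y, R x y → y ∈ S)
    {x x' : β} (h : Reaches g T x x') {y : α} (hxy : R x y) :
    ∃ y', R x' y' ∧ Reaches f S y y' := by
  obtain ⟨t, ht, hT⟩ := h
  induction t generalizing x y with
  | zero =>
    obtain rfl : x = x' := ht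
    exact ⟨y, hxy, refl (hmem x (hT 0 le_rfl) y hxy)⟩
  | succ t ih =>
    obtain ⟨y₁, h₁, r₁⟩ := hstep x (hT 0 (by omega)) (hT 1 (by omega)) y hxy
    obtain ⟨y₂, h₂, r₂⟩ := ih h₁ ht fun s hs => hT (s + 1) (by omega)
    exact ⟨y₂, h₂, r₁.trans r₂⟩

theorem forall_iterate_mem (h : Reaches f S a b) (hb : f b = b) (s : ℕ) : f^[s] a ∈ S := by
  obtain ⟨t, ht, hS⟩ := h
  rcases le_total s t with hs | hs
  · exact hS s hs
  · obtain ⟨r, rfl⟩ := Nat.exists_eq_add_of_le' hs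
    rw [Function.iterate_add_apply, ht, Function.iterate_fixed hb, ← ht]
    exact hS t le_rfl

theorem exists_le_card {F : Finset α} (h : Reaches f (F : Set α) a b) :
    ∃ t ≤ F.card, f^[t] a = b := by
  classical
  obtain ⟨ht, hF⟩ := Nat.find_spec h
  set t := Nat.find h
  have injOn : Set.InjOn (fun s => f^[s] a) (Finset.range t) := by
    -- A repetition could be cut out of the shortest run.
    have no_repetition : ∀ i j, i < j → j ≤ t → f^[i] a ≠ f^[j] a := by
      intro i j hij hj e
      refine Nat.find_min h (m := t - j + i) (by omega) ⟨?_, fun s hs => hF s (by omega)⟩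
      rw [Function.iterate_add_apply, e, ← Function.iterate_add_apply, Nat.sub_add_cancel hj, ht]
    intro i hi j hj e
    simp only [Finset.coe_range, Set.mem_Iio] at hi hj
    rcases lt_trichotomy i j with hij | hij | hij
    · exact absurd e (no_repetition i j hij hj.le)
    · exact hij
    · exact absurd e.symm (no_repetition j i hij hi.le)
  have maps : ∀ s ∈ Finset.range t, f^[s] a ∈ F := fun s hs => hF s (Finset.mem_range_le hs)
  refine ⟨t, ?_, ht⟩
  simpa only [Finset.card_range] using Finset.card_le_card_of_injOn _ maps injOn

end Reaches

/-! ### Tapes seen from the head -/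

open Turing (ListBlank)

/-- The head movement by one cell in the direction `d`, where `1` is to the right. -/
def HeadMove.toward (d : ℤˣ) : HeadMove := if d = 1 then .right else .left

theorem HeadMove.offset_toward (d : ℤˣ) : (HeadMove.toward d).offset = d := by
  rcases Int.units_eq_one_or d with rfl | rfl <;> rfl

theorem abs_add_units_mul_le (p : ℤ) (d : ℤˣ) (n : ℤ) : |p + d * n| ≤ |p| + |n| := by
  simpa [abs_mul, Int.isUnit_iff_abs_eq.1 d.isUnit] using abs_add_le p (d * n)

theorem append_replicate_default {Γ : Type*} [Inhabited Γ] (n : ℕ) :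
    ListBlank.append (List.replicate n default) (∅ : ListBlank Γ) = ∅ := by
  induction n with
  | zero => rfl
  | succ n ih =>
    rw [List.replicate_succ, ListBlank.append, ih]
    exact ListBlank.cons_head_tail (∅ : ListBlank Γ)

namespace TuringMachine

variable {M : TuringMachine}

instance : Inhabited M.Symbol := ⟨M.base .blank⟩

/-- The tape that reads `ahead` on the cells `h`, `h + d`, `h + 2 * d`, … and `behind` on the cells
`h - d`, `h - 2 * d`, …. -/
def tapeAround (h : ℤ) (d : ℤˣ) (behind ahead : ListBlank M.Symbol) : ℤ → M.Symbol :=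
  fun z => match d * (z - h) with
    | .ofNat j => ahead.nth j
    | .negSucc j => behind.nth j

/-- The configuration in which the head looks in the direction `d`. The half-tape `ahead` starts
with the scanned cell and `behind` with the cell before it. -/
def facing (M : TuringMachine) (q : M.State) (h : ℤ) (d : ℤˣ) (behind ahead : ListBlank M.Symbol) :
    M.Config :=
  ⟨q, h, tapeAround h d behind ahead⟩

/-- The configurations whose head is at distance at most `B` from the origin. -/
def within (M : TuringMachine) (B : ℤ) : Set M.Config := {c | |c.head| ≤ B}

theorem eq_tapeAround_iff {t : ℤ → M.Symbol} {h : ℤ} {d : ℤˣ} {L R : ListBlank M.Symbol} :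
    t = tapeAround h d L R ↔
      ∀ j : ℕ, t (h + d * j) = R.nth j ∧ t (h - d * (j + 1)) = L.nth j := by
  have ahead (j : ℕ) : d * (h + d * j - h) = Int.ofNat j := by
    rcases Int.units_eq_one_or d with rfl | rfl <;> simp
  have behind (j : ℕ) : d * (h - d * (j + 1) - h) = Int.negSucc j := by
    rcases Int.units_eq_one_or d with rfl | rfl <;> push_cast <;> omega
  constructor
  · rintro rfl j
    simp only [tapeAround, ahead, behind, and_self]
  · intro ht
    ext z
    have hz : z = h + d * (d * (z - h)) := by
      rcases Int.units_eq_one_or d with rfl | rfl <;> simp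
    simp only [tapeAround]
    split <;> rename_i j hj
    · rw [← (ht j).1, hz, hj, Int.ofNat_eq_natCast]
    · rw [← (ht j).2, hz, hj, Int.negSucc_eq, mul_neg, sub_eq_add_neg]

theorem tapeAround_inj {h : ℤ} {d : ℤˣ} {L L' R R' : ListBlank M.Symbol}
    (e : tapeAround h d L R = tapeAround h d L' R') : L = L' ∧ R = R' := by
  have h' := eq_tapeAround_iff.1 e
  have h₀ := eq_tapeAround_iff.1 (Eq.refl (tapeAround h d L R))
  exact ⟨ListBlank.ext fun j => (h₀ j).2.symm.trans (h' j).2,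
    ListBlank.ext fun j => (h₀ j).1.symm.trans (h' j).1⟩

theorem tapeAround_cons (h : ℤ) (d : ℤˣ) (a : M.Symbol) (L R : ListBlank M.Symbol) :
    tapeAround h d L (R.cons a) = tapeAround (h + d) d (L.cons a) R := by
  rw [eq_tapeAround_iff]
  have h₀ := eq_tapeAround_iff.1 (Eq.refl (tapeAround h d L (R.cons a)))
  refine fun j => ⟨?_, ?_⟩
  · simpa [mul_add, add_assoc, add_comm] using (h₀ (j + 1)).1
  · cases j with
    | zero => simpa using (h₀ 0).1
    | succ j => simpa [mul_add, sub_eq_add_neg, add_assoc, add_comm] using (h₀ j).2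

theorem tapeAround_neg (h : ℤ) (d : ℤˣ) (a : M.Symbol) (L R : ListBlank M.Symbol) :
    tapeAround h (-d) R (L.cons a) = tapeAround h d L (R.cons a) := by
  rw [eq_tapeAround_iff]
  have h₀ := eq_tapeAround_iff.1 (Eq.refl (tapeAround h (-d) R (L.cons a)))
  refine fun j => ⟨?_, ?_⟩
  · cases j with
    | zero => simpa using (h₀ 0).1
    | succ j => simpa using (h₀ j).2
  · simpa [sub_eq_add_neg] using (h₀ (j + 1)).1

theorem tapeAround_self (h : ℤ) (d : ℤˣ) (a : M.Symbol) (L R : ListBlank M.Symbol) :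
    tapeAround h d L (R.cons a) h = a := by
  simp [tapeAround]

theorem update_tapeAround (h : ℤ) (d : ℤˣ) (a b : M.Symbol) (L R : ListBlank M.Symbol) :
    Function.update (tapeAround h d L (R.cons a)) h b = tapeAround h d L (R.cons b) := by
  ext z
  rcases eq_or_ne z h with rfl | hz
  · rw [Function.update_self, tapeAround_self]
  · rw [Function.update_of_ne hz]
    have : d * (z - h) ≠ 0 := mul_ne_zero d.ne_zero (sub_ne_zero.2 hz)
    simp only [tapeAround]
    rcases hj : d * (z - h) with (_ | j) | j
    · exact absurd hj this
    · simp
    · rfl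

theorem facing_neg (q : M.State) (h : ℤ) (d : ℤˣ) (a : M.Symbol) (L R : ListBlank M.Symbol) :
    M.facing q h (-d) R (L.cons a) = M.facing q h d L (R.cons a) :=
  congrArg _ (tapeAround_neg h d a L R)

theorem halted_facing_iff {q : M.State} {h : ℤ} {d : ℤˣ} {a : M.Symbol}
    {L R : ListBlank M.Symbol} :
    M.Halted (M.facing q h d L (R.cons a)) ↔ M.transition q a = none := by
  simp only [Halted, facing, tapeAround_self]

theorem Halted.step_eq {c : M.Config} (hc : M.Halted c) : M.step c = c := by
  rw [step, show M.transition _ _ = none from hc]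

theorem step_facing {q q' : M.State} {h : ℤ} {d : ℤˣ} {a s : M.Symbol} {m : HeadMove}
    {L R : ListBlank M.Symbol} (hq : M.transition q a = some (q', s, m)) :
    M.step (M.facing q h d L (R.cons a)) = ⟨q', h + m.offset, tapeAround h d L (R.cons s)⟩ := by
  simp only [step, facing, tapeAround_self, hq, update_tapeAround]

theorem step_facing_stay {q q' : M.State} {h : ℤ} {d : ℤˣ} {a s : M.Symbol}
    {L R : ListBlank M.Symbol} (hq : M.transition q a = some (q', s, .stay)) :
    M.step (M.facing q h d L (R.cons a)) = M.facing q' h d L (R.cons s) := by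
  rw [step_facing hq, facing, HeadMove.offset, add_zero]

theorem step_facing_forward {q q' : M.State} {h : ℤ} {d : ℤˣ} {a s : M.Symbol}
    {L R : ListBlank M.Symbol} (hq : M.transition q a = some (q', s, .toward d)) :
    M.step (M.facing q h d L (R.cons a)) = M.facing q' (h + d) d (L.cons s) R := by
  rw [step_facing hq, facing, tapeAround_cons, HeadMove.offset_toward]

theorem step_facing_turn {q q' : M.State} {h : ℤ} {d : ℤˣ} {a s : M.Symbol}
    {L R : ListBlank M.Symbol} (hq : M.transition q a = some (q', s, .toward (-d))) :
    M.step (M.facing q h d L (R.cons a)) = M.facing q' (h - d) (-d) (R.cons s) L := by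
  rw [← facing_neg, step_facing_forward hq, Units.val_neg, sub_eq_add_neg]

theorem reaches_sweep {α : Type*} {B : ℤ} {q : M.State} {d : ℤˣ} {read write : α → M.Symbol}
    {l : List α} (hq : ∀ a ∈ l, M.transition q (read a) = some (q, write a, .toward d))
    {h : ℤ} (hB : |h| ≤ B) (hB' : |h + d * l.length| ≤ B) (L R : ListBlank M.Symbol) :
    Reaches M.step (M.within B) (M.facing q h d L (ListBlank.append (l.map read) R))
      (M.facing q (h + d * l.length) d (ListBlank.append (l.map write).reverse L) R) := by
  induction l generalizing h L with
  | nil => simpa using! Reaches.refl (S := M.within B) hB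
  | cons a l ih =>
    simp only [List.length_cons, Nat.cast_succ, mul_add, mul_one] at hB' ⊢
    simp only [List.mem_cons, forall_eq_or_imp] at hq
    have hB₁ : |h + d| ≤ B := by
      rw [abs_le] at hB hB' ⊢
      rcases Int.units_eq_one_or d with rfl | rfl <;> push_cast at hB' ⊢ <;> omega
    have tail := ih hq.2 hB₁ (by rwa [add_assoc, add_comm (d : ℤ)]) (L.cons (write a))
    refine Reaches.head hB ?_
    rw [List.map_cons, ListBlank.append, step_facing_forward hq.1]
    simpa [ListBlank.append_assoc, ListBlank.append, add_assoc, add_comm (d : ℤ)] using tail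

theorem tapeOf_eq (h : ℤ) (w : List BaseSymbol) :
    M.tapeOf h w = tapeAround h 1 ∅ ((ListBlank.mk (w.map M.base)).cons (M.base .blank)) := by
  rw [eq_tapeAround_iff]
  refine fun j => ⟨?_, ?_⟩
  · cases j with
    | zero => simp [tapeOf]
    | succ j =>
      have : h < h + (j + 1) := by omega
      simp [tapeOf, this, List.getI_eq_getElem?_getD, default]
  · exact congrArg M.base (if_neg (by push_cast; omega))

end TuringMachine

/-! ### Simulating a three counter machine on a tape -/

/-- The cells of the simulating tape. Every cell but the `centre` has three tracks, and track `i`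
holds a binary digit of counter `i`. -/
inductive TrackCell : Type
  | blank
  | centre
  | digits (v : Fin 3 → Bool)
  deriving Fintype

/-- The states of the simulation of a counter program with `n` instructions; `n` itself serves as
the address of everything outside the program. -/
inductive TrackState (n : ℕ) : Type
  | seek
  | run (pc : Fin (n + 1))
  /-- Move outward over the digits `b` of counter `i` and flip the first other digit, then go to
  instruction `q`; go to `z` if there is none and the counter is to be decremented. -/
  | scan (i : Fin 3) (b : Bool) (q z : Fin (n + 1))
  /-- Move inward to the centre and set all digits of counter `i` on the way to `b`. -/
  | back (i : Fin 3) (b : Bool) (q : Fin (n + 1))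
  | toEnd
  | erase
  | normalize
  | strip
  | done
  deriving Fintype

namespace TrackCell

instance : Inhabited TrackCell := ⟨.blank⟩

/-- The digits of an input cell: the word to the left of the separator is meant for counter `0` and
the one to the right for counter `1`, while counter `2` is zero. -/
def inputDigits (b : Bool) : Fin 3 → Bool := fun i => b && i != 2

/-- The side of the centre on which the digits of a counter are stored, the least significant one
next to the centre. -/
def side : Fin 3 → ℤˣ := ![-1, 1, 1]

/-- The counter whose digits stand on track `i`, read away from the centre. -/
def value (i : Fin 3) (cells : List (Fin 3 → Bool)) : ℕ :=
  (cells.map fun v => v i).foldr Nat.bit 0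

end TrackCell

namespace CounterProgram

open TuringMachine TrackCell Function

/-- The contents of the counters on a tape with the cells `T d` on side `d` of the centre. -/
def counters (T : ℤˣ → List (Fin 3 → Bool)) : Fin 3 → ℕ := fun i => value i (T (side i))

/-- The transitions of the simulating machine. -/
def trackTransition (P : CounterProgram 3) :
    TrackState P.length → TrackCell → Option (TrackState P.length × TrackCell × HeadMove)
  | .seek, .centre => some (.run 0, .centre, .stay)
  | .seek, a => some (.seek, a, .toward 1)
  | .run pc, .centre =>
      match P[(pc : ℕ)]? with
      | some (.inc i) =>
          some (.scan i true (.clamp (pc + 1) _) (.clamp (pc + 1) _), .centre, .toward (side i))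
      | some (.dec i t) =>
          some (.scan i false (.clamp (pc + 1) _) (.clamp t _), .centre, .toward (side i))
      | some (.jump t) => some (.run (.clamp t _), .centre, .stay)
      | some .halt => some (.toEnd, .centre, .toward 1)
      | none => none
  | .scan i b q z, .digits v =>
      if v i = b then some (.scan i b q z, .digits v, .toward (side i))
      else some (.back i (!b) q, .digits (update v i b), .toward (-side i))
  | .scan i true q _, .blank =>
      some (.back i false q, .digits (update (fun _ => false) i true), .toward (-side i))
  | .scan i false _ z, .blank => some (.back i false z, .blank, .toward (-side i))
  | .back i b q, .digits v => some (.back i b q, .digits (update v i b), .toward (-side i))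
  | .back _ _ q, .centre => some (.run q, .centre, .stay)
  | .toEnd, .digits v => some (.toEnd, .digits v, .toward 1)
  | .toEnd, .blank => some (.erase, .blank, .toward (-1))
  | .erase, .digits _ => some (.erase, .blank, .toward (-1))
  | .erase, .centre => some (.normalize, .blank, .toward (-1))
  | .normalize, .digits v => some (.normalize, .digits (inputDigits (v 0)), .toward (-1))
  | .normalize, .blank => some (.strip, .blank, .toward 1)
  | .strip, .digits v =>
      if v 0 then some (.done, .digits v, .toward (-1)) else some (.strip, .blank, .toward 1)
  | _, _ => none

/-- The Turing machine that runs a three counter program on counters kept in binary. -/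
abbrev trackMachine (P : CounterProgram 3) : TuringMachine where
  State := TrackState P.length
  Symbol := TrackCell
  base :=
    { toFun := fun
        | .blank => .blank
        | .zero => .digits (inputDigits false)
        | .one => .digits (inputDigits true)
        | .sep => .centre
      inj' := by
        have : inputDigits false ≠ inputDigits true := by decide
        rintro (_ | _) (_ | _) <;> simp [this, this.symm] }
  start := .seek
  transition := P.trackTransition

end CounterProgram

namespace TrackCell

open Function

variable {i : Fin 3} {cells : List (Fin 3 → Bool)}

theorem value_cons (i : Fin 3) (v : Fin 3 → Bool) (cells : List (Fin 3 → Bool)) :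
    value i (v :: cells) = Nat.bit (v i) (value i cells) :=
  rfl

theorem value_add_one_of_forall_true (h : ∀ v ∈ cells, v i = true) :
    value i cells + 1 = 2 ^ cells.length := by
  induction cells with
  | nil => rfl
  | cons v cells ih =>
    simp only [List.mem_cons, forall_eq_or_imp] at h
    have := ih h.2
    simp only [value_cons, List.length_cons, pow_succ, Nat.bit_val, h.1, Bool.toNat_true]
    omega

theorem value_of_forall_false (h : ∀ v ∈ cells, v i = false) : value i cells = 0 := by
  induction cells with
  | nil => rfl
  | cons v cells ih =>
    simp only [List.mem_cons, forall_eq_or_imp] at h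
    rw [value_cons, h.1, ih h.2, Nat.bit_false_zero]

theorem value_append_zero (i : Fin 3) (cells : List (Fin 3 → Bool)) :
    value i (cells ++ [fun _ => false]) = value i cells := by
  simp [value]

/-- For `b = true` this is a carry through digits `1`, for `b = false` a borrow through digits
`0`. -/
theorem value_ripple {b : Bool} {v : Fin 3 → Bool} (h : ∀ u ∈ cells, u i = b) (hv : v i = !b)
    (cells' : List (Fin 3 → Bool)) :
    value i ((cells.map fun u => update u i !b) ++ update v i b :: cells') + (!b).toNat =
      value i (cells ++ v :: cells') + b.toNat := by
  induction cells with
  | nil =>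
    simp only [List.map_nil, List.nil_append, value_cons, update_self, hv, Nat.bit_val]
    omega
  | cons u cells ih =>
    simp only [List.mem_cons, forall_eq_or_imp] at h
    have := ih h.2
    simp only [List.map_cons, List.cons_append, value_cons, Nat.bit_val, h.1, update_self]
    omega

theorem value_inputDigits (n : ℕ) (i : Fin 3) :
    value i (n.bits.map inputDigits) = if i = 2 then 0 else n := by
  induction n using Nat.binaryRec' with
  | zero => simp [value]
  | bit b n h ih =>
    rw [Nat.bits_append_bit _ _ h, List.map_cons, value_cons, ih]
    rcases eq_or_ne i 2 with rfl | hi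
    · simp [inputDigits]
    · simp [inputDigits, hi, bne_iff_ne.2 hi]

theorem exists_map_eq_bits_append_replicate (i : Fin 3) (cells : List (Fin 3 → Bool)) :
    ∃ k, (cells.map fun v => v i) = (value i cells).bits ++ List.replicate k false := by
  induction cells with
  | nil => exact ⟨0, by simp [value]⟩
  | cons v cells ih =>
    obtain ⟨k, hk⟩ := ih
    by_cases h : value i cells = 0 → v i = true
    · refine ⟨k, ?_⟩
      rw [List.map_cons, hk]
      exact congrArg (· ++ _) (Nat.bits_append_bit _ _ h).symm
    · push Not at h
      refine ⟨k + 1, ?_⟩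
      simp [value_cons, hk, h, List.replicate_succ]

end TrackCell

namespace CounterProgram

open TuringMachine TrackCell Function

variable {P : CounterProgram 3} {B p : ℤ} {T : ℤˣ → List (Fin 3 → Bool)}

/-- The half-tape with the given cells. -/
def half (P : CounterProgram 3) (cells : List (Fin 3 → Bool)) : ListBlank P.trackMachine.Symbol :=
  ListBlank.append (cells.map .digits) ∅

/-- The configuration at the centre `p` of a tape with the cells `T d` on side `d`. -/
def display (q : TrackState P.length) (p : ℤ) (T : ℤˣ → List (Fin 3 → Bool)) :
    P.trackMachine.Config :=
  P.trackMachine.facing q p 1 (P.half (T (-1))) ((P.half (T 1)).cons .centre)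

theorem display_eq_facing (q : TrackState P.length) (p : ℤ) (T : ℤˣ → List (Fin 3 → Bool))
    (d : ℤˣ) : display q p T =
      P.trackMachine.facing q p d (P.half (T (-d))) ((P.half (T d)).cons .centre) := by
  rcases Int.units_eq_one_or d with rfl | rfl
  · rfl
  · exact (facing_neg (M := P.trackMachine) _ _ _ _ _ _).symm

theorem reaches_scan {i : Fin 3} {b b' : Bool} {q z r : Fin (P.length + 1)}
    {a a' : P.trackMachine.Symbol}
    (ha : P.trackTransition (.scan i b q z) a = some (.back i b' r, a', .toward (-side i)))
    {pre : List (Fin 3 → Bool)} (hpre : ∀ v ∈ pre, v i = b) (hB : |p| + (pre.length + 1) ≤ B)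
    (L R : ListBlank P.trackMachine.Symbol) :
    Reaches P.trackMachine.step (P.trackMachine.within B)
      (P.trackMachine.facing (.scan i b q z) (p + side i) (side i) (L.cons .centre)
        (ListBlank.append (pre.map .digits) (R.cons a)))
      (P.trackMachine.facing (.run r) p (side i) L
        ((ListBlank.append (pre.map fun v => .digits (update v i b')) (R.cons a')).cons
          .centre)) := by
  have hmem (n : ℤ) (h₀ : 0 ≤ n) (hn : n ≤ pre.length + 1) : |p + side i * n| ≤ B :=
    (abs_add_units_mul_le p (side i) n).trans (by rw [abs_of_nonneg h₀]; omega)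
  have h₁ : |p + side i| ≤ B := by simpa using hmem 1 (by omega) (by omega)
  have h₂ : |p + side i + side i * pre.length| ≤ B := by
    simpa [mul_add, add_assoc, add_comm] using hmem (pre.length + 1) (by omega) (by omega)
  have h₃ : |p + side i * pre.length| ≤ B := hmem pre.length (by omega) (by omega)
  have h₀ : |p| ≤ B := by omega
  have out := reaches_sweep (M := P.trackMachine) (q := .scan i b q z) (d := side i) (l := pre)
    (read := .digits) (write := .digits)
    (fun v hv => by simp [trackTransition, hpre v hv]) h₁ h₂ (L.cons .centre) (R.cons a)
  have inward := reaches_sweep (M := P.trackMachine) (q := .back i b' r) (d := -side i)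
    (l := pre.reverse) (read := .digits) (write := fun v => .digits (update v i b'))
    (fun _ _ => by simp [trackTransition]) h₃ (by simpa using h₀)
    (R.cons a') (L.cons .centre)
  refine out.trans (.head h₂ ?_)
  rw [step_facing_turn ha, ← List.map_reverse,
    show p + side i + side i * pre.length - side i = p + side i * pre.length by ring]
  refine inward.trans (.single (by simpa using! h₀) h₀ ?_)
  rw [step_facing_stay (by rfl), facing_neg]
  simp

theorem reaches_display {i : Fin 3} {b b' : Bool} {pc q z r : Fin (P.length + 1)} {a a' : TrackCell}
    (hpc : P.trackTransition (.run pc) .centre = some (.scan i b q z, .centre, .toward (side i)))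
    (ha : P.trackTransition (.scan i b q z) a = some (.back i b' r, a', .toward (-side i)))
    {pre cells : List (Fin 3 → Bool)} (hpre : ∀ v ∈ pre, v i = b)
    (hB : |p| + (pre.length + 1) ≤ B) (R : ListBlank TrackCell)
    (hT : P.half (T (side i)) = ListBlank.append (pre.map .digits) (R.cons a))
    (hcells : P.half cells =
      ListBlank.append (pre.map fun v => .digits (update v i b')) (R.cons a')) :
    Reaches P.trackMachine.step (P.trackMachine.within B) (display (.run pc) p T)
      (display (.run r) p (update T (side i) cells)) := by
  have hne : -side i ≠ side i := by
    generalize side i = d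
    decide +revert
  rw [display_eq_facing _ _ _ (side i), display_eq_facing _ _ _ (side i), update_self,
    update_of_ne hne, hT, hcells]
  refine .head (show |p| ≤ B by omega) ?_
  rw [step_facing_forward hpc]
  exact reaches_scan ha hpre hB _ R

theorem counters_update (T : ℤˣ → List (Fin 3 → Bool)) {i : Fin 3} {cells : List (Fin 3 → Bool)}
    (h : ∀ j ≠ i, value j cells = value j (T (side i))) :
    counters (update T (side i) cells) = update (counters T) i (value i cells) := by
  ext j
  rcases eq_or_ne j i with rfl | hj
  · simp [counters]
  · by_cases hs : side j = side i
    · simp [counters, hj, hs, h j hj]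
    · simp [counters, hj, hs]

theorem find_other_digit (i : Fin 3) (b : Bool) (cells : List (Fin 3 → Bool)) :
    (∀ v ∈ cells, v i = b) ∨
      ∃ pre v post, cells = pre ++ v :: post ∧ (∀ u ∈ pre, u i = b) ∧ v i = !b := by
  rcases hf : cells.find? fun v => v i == !b with _ | v
  · left; simpa using List.find?_eq_none.1 hf
  · obtain ⟨hv, pre, post, rfl, hpre⟩ := List.find?_eq_some_iff_append.1 hf
    exact .inr ⟨pre, v, post, rfl, by simpa using hpre, by simpa using hv⟩

theorem reaches_flip {i : Fin 3} {b : Bool} {pc q z : Fin (P.length + 1)}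
    (hpc : P.trackTransition (.run pc) .centre = some (.scan i b q z, .centre, .toward (side i)))
    {pre post : List (Fin 3 → Bool)} {v : Fin 3 → Bool} (hpre : ∀ u ∈ pre, u i = b)
    (hv : v i = !b) (hT : T (side i) = pre ++ v :: post)
    (hB : |p| + ((T (side i)).length + 1) ≤ B) :
    ∃ T' n, (∀ d, (T' d).length = (T d).length) ∧ counters T' = update (counters T) i n ∧
      n + (!b).toNat = counters T i + b.toNat ∧
      Reaches P.trackMachine.step (P.trackMachine.within B) (display (.run pc) p T)
        (display (.run q) p T') := by
  refine ⟨update T (side i) ((pre.map fun u => update u i !b) ++ update v i b :: post), _, ?_,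
    counters_update T ?_, ?_, reaches_display hpc (a := .digits v) (a' := .digits (update v i b))
      (b' := !b) ?_ hpre ?_ (P.half post) ?_ ?_⟩
  · intro d
    rcases eq_or_ne d (side i) with rfl | hd <;> simp [*]
  · intro j hj
    simp [value, hT, hj, comp_def]
  · rw [counters, hT]
    exact value_ripple hpre hv post
  · simp [trackTransition, hv]
  · simp only [hT, List.length_append] at hB
    omega
  · simp [half, hT, ListBlank.append_assoc, ListBlank.append]
  · simp [half, ListBlank.append_assoc, ListBlank.append, comp_def]

theorem half_eq_append_blank (cells : List (Fin 3 → Bool)) :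
    P.half cells = ListBlank.append (cells.map .digits) ((∅ : ListBlank TrackCell).cons .blank) :=
  congrArg _ (ListBlank.cons_head_tail _).symm

theorem reaches_inc {N : ℕ} {i : Fin 3} {pc q z : Fin (P.length + 1)}
    (hpc : P.trackTransition (.run pc) .centre = some (.scan i true q z, .centre, .toward (side i)))
    (hT : ∀ d, (T d).length ≤ N) (hN : counters T i + 1 < 2 ^ N) (hB : |p| + (N + 1) ≤ B) :
    ∃ T', (∀ d, (T' d).length ≤ N) ∧ counters T' = update (counters T) i (counters T i + 1) ∧
      Reaches P.trackMachine.step (P.trackMachine.within B) (display (.run pc) p T)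
        (display (.run q) p T') := by
  have hB' : |p| + ((T (side i)).length + 1) ≤ B := by have := hT (side i); omega
  rcases find_other_digit i true (T (side i)) with hall | ⟨pre, v, post, e, hpre, hv⟩
  · -- All digits are `1`, and the carry adds a cell.
    have hlt : (T (side i)).length < N := by
      rw [counters, value_add_one_of_forall_true hall] at hN
      exact (Nat.pow_lt_pow_iff_right one_lt_two).1 hN
    have hval := value_ripple hall (v := fun _ => false) rfl []
    rw [value_append_zero] at hval
    refine ⟨update T (side i) (((T (side i)).map fun v => update v i false) ++
      [update (fun _ => false) i true]), fun d => ?_, ?_,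
      reaches_display hpc rfl hall hB' ∅ (half_eq_append_blank _) ?_⟩
    · rcases eq_or_ne d (side i) with rfl | hd
      · simpa using hlt
      · simpa [hd] using hT d
    · rw [counters_update T fun j hj => by simp [value, hj, comp_def]]
      exact congrArg _ hval
    · simp [half, ListBlank.append_assoc, ListBlank.append, comp_def]
  · obtain ⟨T', n, hlen, hT', hn, hr⟩ := reaches_flip hpc hpre hv e hB'
    exact ⟨T', fun d => (hlen d).trans_le (hT d), hn ▸ hT', hr⟩

theorem reaches_dec {N : ℕ} {i : Fin 3} {pc q z : Fin (P.length + 1)}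
    (hpc : P.trackTransition (.run pc) .centre =
      some (.scan i false q z, .centre, .toward (side i)))
    (hT : ∀ d, (T d).length ≤ N) (hi : 0 < counters T i) (hB : |p| + (N + 1) ≤ B) :
    ∃ T', (∀ d, (T' d).length ≤ N) ∧ counters T' = update (counters T) i (counters T i - 1) ∧
      Reaches P.trackMachine.step (P.trackMachine.within B) (display (.run pc) p T)
        (display (.run q) p T') := by
  have hB' : |p| + ((T (side i)).length + 1) ≤ B := by have := hT (side i); omega
  rcases find_other_digit i false (T (side i)) with hall | ⟨pre, v, post, e, hpre, hv⟩
  · exact absurd (value_of_forall_false hall) hi.ne'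
  · obtain ⟨T', n, hlen, hT', hn, hr⟩ := reaches_flip hpc hpre hv e hB'
    rw [Nat.eq_sub_of_add_eq hn] at hT'
    exact ⟨T', fun d => (hlen d).trans_le (hT d), hT', hr⟩

theorem reaches_dec_zero {i : Fin 3} {pc q z : Fin (P.length + 1)}
    (hpc : P.trackTransition (.run pc) .centre =
      some (.scan i false q z, .centre, .toward (side i)))
    (hi : counters T i = 0) (hB : |p| + ((T (side i)).length + 1) ≤ B) :
    Reaches P.trackMachine.step (P.trackMachine.within B) (display (.run pc) p T)
      (display (.run z) p T) := by
  rcases find_other_digit i false (T (side i)) with hall | ⟨pre, v, post, e, hpre, hv⟩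
  · have unchanged : (T (side i)).map (fun v => TrackCell.digits (update v i false)) =
        (T (side i)).map .digits :=
      List.map_congr_left fun v hv => by rw [← hall v hv, update_eq_self]
    have h := half_eq_append_blank (P := P) (T (side i))
    have hr := reaches_display hpc rfl hall hB ∅ h (unchanged ▸ h)
    rwa [update_eq_self] at hr
  · obtain ⟨_, n, -, -, hn, -⟩ := reaches_flip hpc hpre hv e hB
    simp [hi] at hn

/-- The configurations that represent `c`, with the centre of the tape on cell `p` and at most `N`
cells in use on either side of it. -/
def Represents (P : CounterProgram 3) (p : ℤ) (N : ℕ) (c : CounterConfig 3)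
    (y : P.trackMachine.Config) : Prop :=
  ∃ T, (∀ d, (T d).length ≤ N) ∧ counters T = c.val ∧ y = display (.run (.clamp c.pc _)) p T

theorem getElem?_clamp (P : CounterProgram 3) (n : ℕ) :
    P[(Fin.clamp n P.length : ℕ)]? = P[n]? := by
  rcases le_total n P.length with h | h <;> simp [Fin.coe_clamp, h]

theorem clamp_clamp_add_one (n m : ℕ) :
    Fin.clamp (Fin.clamp n m + 1) m = Fin.clamp (n + 1) m := by
  ext
  simp only [Fin.coe_clamp]
  omega

theorem trackTransition_inc {n : ℕ} {i : Fin 3} (h : P[n]? = some (.inc i)) :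
    P.trackTransition (.run (.clamp n _)) .centre =
      some (.scan i true (.clamp (n + 1) _) (.clamp (n + 1) _), .centre, .toward (side i)) := by
  simp only [trackTransition, getElem?_clamp, h, clamp_clamp_add_one]

theorem trackTransition_dec {n t : ℕ} {i : Fin 3} (h : P[n]? = some (.dec i t)) :
    P.trackTransition (.run (.clamp n _)) .centre =
      some (.scan i false (.clamp (n + 1) _) (.clamp t _), .centre, .toward (side i)) := by
  simp only [trackTransition, getElem?_clamp, h, clamp_clamp_add_one]

theorem represents_step {N : ℕ} (hB : |p| + (N + 1) ≤ B) {c : CounterConfig 3}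
    (hN : ∀ i, (P.step c).val i < 2 ^ N) {y : P.trackMachine.Config} (hy : P.Represents p N c y) :
    ∃ y', P.Represents p N (P.step c) y' ∧
      Reaches P.trackMachine.step (P.trackMachine.within B) y y' := by
  obtain ⟨T, hT, hval, rfl⟩ := hy
  have hp : |p| ≤ B := by omega
  unfold step at hN ⊢
  rcases hc : P[c.pc]? with _ | i | ⟨i, t⟩ | t | _ <;> simp only [hc] at hN ⊢
  · exact ⟨_, ⟨T, hT, hval, rfl⟩, .refl hp⟩
  · obtain ⟨T', hT', hval', hr⟩ :=
      reaches_inc (trackTransition_inc hc) hT (by simpa [hval] using hN i) hB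
    exact ⟨_, ⟨T', hT', hval ▸ hval', rfl⟩, hr⟩
  · split_ifs with hi
    · obtain ⟨T', hT', hval', hr⟩ := reaches_dec (trackTransition_dec hc) hT (by rwa [hval]) hB
      exact ⟨_, ⟨T', hT', hval ▸ hval', rfl⟩, hr⟩
    · have hB' : |p| + ((T (side i)).length + 1) ≤ B := by have := hT (side i); omega
      exact ⟨_, ⟨T, hT, hval, rfl⟩,
        reaches_dec_zero (trackTransition_dec hc) (by rw [hval]; omega) hB'⟩
  · refine ⟨_, ⟨T, hT, hval, rfl⟩, .single hp hp (step_facing_stay ?_)⟩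
    simp only [trackTransition, getElem?_clamp, hc]
  · exact ⟨_, ⟨T, hT, hval, rfl⟩, .refl hp⟩

end CounterProgram

theorem length_pairInput (x y : ℕ) :
    (pairInput x y).length = x.bits.length + y.bits.length + 1 := by
  simp [pairInput, bin, add_assoc]

theorem lt_two_pow_length_bits (n : ℕ) : n < 2 ^ n.bits.length := by
  rw [Nat.size_eq_bits_len]
  exact n.lt_size_self

theorem bin_eq_nil_or_one_cons (n : ℕ) : bin n = [] ∨ ∃ w, bin n = .one :: w := by
  induction n using Nat.binaryRec' with
  | zero => exact .inl rfl
  | bit b n h ih =>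
    have hbin : bin (Nat.bit b n) = bin n ++ [if b then .one else .zero] := by
      simp [bin, Nat.bits_append_bit _ _ h]
    right
    rcases ih with h₀ | ⟨w, hw⟩
    · have hn : n = 0 := by
        rw [← Nat.size_eq_zero, ← Nat.size_eq_bits_len]
        simpa [bin] using h₀
      exact ⟨[], by rw [hbin, h₀, h hn]; rfl⟩
    · exact ⟨w ++ [if b then .one else .zero], by simp [hbin, hw]⟩

namespace CounterProgram

open TuringMachine TrackCell Function

variable {P : CounterProgram 3} {B p : ℤ} {N : ℕ}

theorem map_base_bin (P : CounterProgram 3) (n : ℕ) :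
    (bin n).map P.trackMachine.base = (n.bits.map fun b => .digits (inputDigits b)).reverse := by
  rw [bin, List.map_reverse, List.map_map]
  congr 2
  ext b
  cases b <;> rfl

theorem tapeOf_pairInput (P : CounterProgram 3) (x y : ℕ) :
    P.trackMachine.tapeOf 0 (pairInput x y) = tapeAround 0 1 ∅ (ListBlank.append
      (TrackCell.blank :: (x.bits.map fun b => .digits (inputDigits b)).reverse)
      ((P.half (y.bits.map inputDigits)).cons TrackCell.centre)) := by
  have empty : (∅ : ListBlank TrackCell) = .mk [] := rfl
  rw [tapeOf_eq, pairInput, List.map_append, List.map_cons, List.map_reverse, map_base_bin,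
    map_base_bin, List.reverse_reverse, half, empty, List.map_map]
  simp only [ListBlank.append, ListBlank.append_mk, ListBlank.cons_mk, List.append_nil]
  rfl

theorem reaches_represents_input {x y : ℕ} (hx : x.bits.length ≤ N) (hy : y.bits.length ≤ N)
    (hB : N + 1 ≤ B) :
    ∃ c, P.Represents (x.bits.length + 1) N ⟨0, ![x, y, 0]⟩ c ∧
      Reaches P.trackMachine.step (P.trackMachine.within B)
        (P.trackMachine.init (pairInput x y)) c := by
  set T : ℤˣ → List (Fin 3 → Bool) :=
    update (fun _ => y.bits.map inputDigits) (-1) (x.bits.map inputDigits) with hT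
  refine ⟨display (.run 0) (x.bits.length + 1) T, ⟨T, fun d => ?_, ?_, rfl⟩, ?_⟩
  · rcases Int.units_eq_one_or d with rfl | rfl <;> simpa [hT]
  · ext i
    fin_cases i <;> simp [counters, side, hT, value_inputDigits]
  · rw [init, tapeOf_pairInput]
    have h₀ : |(0 : ℤ)| ≤ B := by rw [abs_zero]; omega
    have h₁ : |(x.bits.length + 1 : ℤ)| ≤ B := by rw [abs_le]; omega
    have sweep := reaches_sweep (M := P.trackMachine) (q := .seek) (d := 1) (read := id)
      (write := id) (l := .blank :: (x.bits.map fun b => .digits (inputDigits b)).reverse)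
      (fun a ha => by
        simp only [List.mem_cons, List.mem_reverse, List.mem_map] at ha
        rcases ha with rfl | ⟨b, -, rfl⟩ <;> rfl) h₀ (by simpa using! h₁) ∅
      ((P.half (y.bits.map inputDigits)).cons .centre)
    rw [List.map_id] at sweep
    refine sweep.trans (.single (by simpa using! h₁) h₁ ?_)
    rw [step_facing_stay (M := P.trackMachine) (q' := .run 0) (s := .centre) (by rfl)]
    rw [display, half_eq_append_blank (T (-1))]
    simp [hT, half, comp_def, ListBlank.append, ListBlank.append_assoc]

theorem cons_blank_empty : (∅ : ListBlank TrackCell).cons .blank = ∅ :=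
  ListBlank.cons_head_tail ∅

theorem reaches_erase {pc : Fin (P.length + 1)} (hpc : P[(pc : ℕ)]? = some .halt)
    {T : ℤˣ → List (Fin 3 → Bool)} (hB : |p| + ((T 1).length + 1) ≤ B) :
    Reaches P.trackMachine.step (P.trackMachine.within B) (display (.run pc) p T)
      (P.trackMachine.facing .normalize (p - 1) (-1) ∅ (P.half (T (-1)))) := by
  set n := (T 1).length with hn
  have hp := abs_le.1 (le_refl |p|)
  have h₀ : |p| ≤ B := by omega
  have h₁ : |p + 1| ≤ B := by rw [abs_le]; omega
  have h₂ : |p + 1 + n| ≤ B := by rw [abs_le]; omega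
  have h₃ : |p + n| ≤ B := by rw [abs_le]; omega
  have h₄ : |p - 1| ≤ B := by rw [abs_le]; omega
  have out := reaches_sweep (M := P.trackMachine) (q := .toEnd) (d := 1) (l := T 1)
    (read := .digits) (write := .digits) (fun _ _ => rfl) h₁ (by simpa using! h₂)
    ((P.half (T (-1))).cons .centre) (((∅ : ListBlank TrackCell)).cons .blank)
  have inward := reaches_sweep (M := P.trackMachine) (q := .erase) (d := -1) (l := (T 1).reverse)
    (read := .digits) (write := fun _ => .blank) (fun _ _ => rfl) h₃ (by simpa [n] using h₀)
    ∅ ((P.half (T (-1))).cons .centre)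
  have leave : P.trackTransition (.run pc) .centre = some (.toEnd, .centre, .toward 1) := by
    simp only [trackTransition, hpc]
  refine .head h₀ ?_
  rw [display, step_facing_forward leave, half_eq_append_blank (T 1)]
  refine out.trans (.head (by simpa using! h₂) ?_)
  rw [step_facing_turn (by rfl), cons_blank_empty, ← List.map_reverse, ← hn,
    show p + 1 + (1 : ℤˣ) * n - (1 : ℤˣ) = p + n by push_cast; ring]
  refine inward.trans (.single (by simpa [n] using! h₀) h₄ ?_)
  have erased : ListBlank.append (List.replicate n TrackCell.blank) ∅ = ∅ :=
    append_replicate_default n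
  rw [step_facing_forward (by rfl), List.map_const', List.reverse_replicate, List.length_reverse,
    ← hn, erased, cons_blank_empty]
  exact congrArg (P.trackMachine.facing _ · _ _ _) (by push_cast; ring)

theorem reaches_normalize {cells : List (Fin 3 → Bool)} (hB : |p| + (cells.length + 1) ≤ B) :
    Reaches P.trackMachine.step (P.trackMachine.within B)
      (P.trackMachine.facing .normalize (p - 1) (-1) ∅ (P.half cells))
      (P.trackMachine.facing .strip (p - cells.length) 1 ∅
        (.mk (cells.map fun v => .digits (inputDigits (v 0))).reverse)) := by
  have hp := abs_le.1 (le_refl |p|)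
  have h₀ : |p - 1| ≤ B := by rw [abs_le]; omega
  have h₁ : |p - 1 - cells.length| ≤ B := by rw [abs_le]; omega
  have h₂ : |p - cells.length| ≤ B := by rw [abs_le]; omega
  have sweep := reaches_sweep (M := P.trackMachine) (q := .normalize) (d := -1) (l := cells)
    (read := .digits) (write := fun v => .digits (inputDigits (v 0))) (fun _ _ => rfl) h₀
    (by simpa [sub_eq_add_neg] using h₁) ∅ (((∅ : ListBlank TrackCell)).cons .blank)
  rw [half_eq_append_blank]
  refine sweep.trans (.single (by simpa [sub_eq_add_neg] using! h₁) h₂ ?_)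
  rw [step_facing_turn (by rfl), cons_blank_empty,
    show p - 1 + (-1 : ℤˣ) * cells.length - (-1 : ℤˣ) = p - cells.length by push_cast; ring,
    neg_neg]
  exact congrArg _ ((ListBlank.append_mk _ []).trans (by rw [List.append_nil]))

theorem exists_halted_strip {n : ℕ} {h : ℤ} (hB : |h| ≤ B) (hB' : |h - 1| ≤ B) :
    ∃ c, P.trackMachine.Halted c ∧ c.tape = P.trackMachine.tapeOf c.head (bin n) ∧
      Reaches P.trackMachine.step (P.trackMachine.within B)
        (P.trackMachine.facing .strip h 1 ∅ (.mk ((bin n).map P.trackMachine.base))) c := by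
  rcases bin_eq_nil_or_one_cons n with hw | ⟨v, hw⟩
  · refine ⟨P.trackMachine.facing .strip h 1 ∅ ((ListBlank.mk []).cons .blank),
      halted_facing_iff.2 rfl, hw ▸ (tapeOf_eq h []).symm, ?_⟩
    rw [hw]
    refine (congrArg (P.trackMachine.facing .strip h 1 ∅) cons_blank_empty) ▸ ?_
    exact .refl hB
  · refine ⟨P.trackMachine.facing .done (h - 1) 1 ∅
      ((ListBlank.mk ((bin n).map P.trackMachine.base)).cons .blank), ?_, ?_, ?_⟩
    · exact halted_facing_iff.2 rfl
    · exact (tapeOf_eq _ _).symm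
    · refine .single hB hB' ?_
      rw [hw, List.map_cons, ← ListBlank.cons_mk]
      refine (step_facing_turn (M := P.trackMachine) (q := .strip) (q' := .done) (d := 1)
        rfl).trans ?_
      rw [← facing_neg, cons_blank_empty]
      rfl

theorem reaches_strip {n k : ℕ} {h : ℤ} (hB : |h| ≤ B) (hB' : |h + k| ≤ B) :
    Reaches P.trackMachine.step (P.trackMachine.within B)
      (P.trackMachine.facing .strip h 1 ∅ (.mk ((n.bits ++
        List.replicate k false).map fun b => .digits (inputDigits b)).reverse))
      (P.trackMachine.facing .strip (h + k) 1 ∅ (.mk ((bin n).map P.trackMachine.base))) := by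
  have sweep := reaches_sweep (M := P.trackMachine) (q := .strip) (d := 1)
    (l := List.replicate k false) (read := fun b => .digits (inputDigits b))
    (write := fun _ => .blank)
    (fun b hb => by rw [List.eq_of_mem_replicate hb]; rfl) hB (by simpa using hB') ∅
    (.mk (n.bits.map fun b => .digits (inputDigits b)).reverse)
  have erased : ListBlank.append (List.replicate k TrackCell.blank) ∅ = ∅ :=
    append_replicate_default k
  rw [map_base_bin]
  simpa [erased] using sweep

theorem exists_halted_output {pc : Fin (P.length + 1)} (hpc : P[(pc : ℕ)]? = some .halt)
    {T : ℤˣ → List (Fin 3 → Bool)} (hT : ∀ d, (T d).length ≤ N) (hB : |p| + (N + 1) ≤ B) :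
    ∃ c, P.trackMachine.Halted c ∧ c.tape = P.trackMachine.tapeOf c.head (bin (counters T 0)) ∧
      Reaches P.trackMachine.step (P.trackMachine.within B) (display (.run pc) p T) c := by
  have h₁ := hT 1
  have h₂ := hT (-1)
  have hp := abs_le.1 (le_refl |p|)
  set cells := T (-1)
  obtain ⟨k, hk⟩ := exists_map_eq_bits_append_replicate 0 cells
  have hlen : k ≤ cells.length := by
    have := congrArg List.length hk
    rw [List.length_map, List.length_append, List.length_replicate] at this
    omega
  have h₃ : |p - cells.length| ≤ B := by rw [abs_le]; omega
  have h₄ : |p - cells.length + k| ≤ B := by rw [abs_le]; omega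
  have h₅ : |p - cells.length + k - 1| ≤ B := by rw [abs_le]; omega
  have normalize := reaches_normalize (P := P) (p := p) (B := B) (cells := cells) (by omega)
  have normalized : (cells.map fun v => TrackCell.digits (inputDigits (v 0))) =
      ((value 0 cells).bits ++ List.replicate k false).map fun b => .digits (inputDigits b) := by
    rw [← hk, List.map_map, comp_def]
  rw [normalized] at normalize
  obtain ⟨c, hc, htape, hr⟩ := exists_halted_strip (P := P) (n := value 0 cells) h₄ h₅
  refine ⟨c, hc, htape, (reaches_erase hpc (by omega)).trans (normalize.trans ?_)⟩
  exact (reaches_strip h₃ h₄).trans hr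

end CounterProgram

namespace CounterProgram

open Function

variable {k : ℕ} {c : CounterConfig k} {n : ℕ}

theorem step_val_le (P : CounterProgram k) (h : ∀ i, c.val i ≤ n) (i : Fin k) :
    (P.step c).val i ≤ n + 1 := by
  have hi := h i
  unfold step
  split
  · rename_i j _
    rcases eq_or_ne i j with rfl | hij
    · simpa using hi
    · simp [hij, hi.trans n.le_succ]
  · rename_i j _ _
    split_ifs
    · rcases eq_or_ne i j with rfl | hij
      · simp only [update_self]
        omega
      · simp [hij, hi.trans n.le_succ]
    · exact hi.trans n.le_succ
  all_goals exact hi.trans n.le_succ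

theorem iterate_step_val_le (P : CounterProgram k) (h : ∀ i, c.val i ≤ n) (t : ℕ) (i : Fin k) :
    (P.step^[t] c).val i ≤ n + t := by
  induction t generalizing i with
  | zero => exact h i
  | succ t ih =>
    rw [iterate_succ_apply']
    exact P.step_val_le ih i

theorem exists_trackMachine_output {P : CounterProgram 3} {x y t N B : ℕ} (hx : x.bits.length ≤ N)
    (hy : y.bits.length ≤ N) (hN : ∀ s ≤ t, ∀ i, (P.step^[s] ⟨0, ![x, y, 0]⟩).val i < 2 ^ N)
    (hP : P.Halted (P.step^[t] ⟨0, ![x, y, 0]⟩)) (hB : x.bits.length + 1 + (N + 1) ≤ B) :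
    ∃ c, P.trackMachine.Halted c ∧
      c.tape = P.trackMachine.tapeOf c.head (bin ((P.step^[t] ⟨0, ![x, y, 0]⟩).val 0)) ∧
      Reaches P.trackMachine.step (P.trackMachine.within B)
        (P.trackMachine.init (pairInput x y)) c := by
  set p : ℤ := x.bits.length + 1
  have hp : |p| + (N + 1) ≤ B := by rw [abs_of_nonneg (by omega)]; omega
  obtain ⟨a, ha, hinput⟩ := reaches_represents_input (P := P) (B := B) hx hy (by omega)
  obtain ⟨b, ⟨T, hT, hval, rfl⟩, hrun⟩ := Reaches.simulate
    (T := {c : CounterConfig 3 | ∀ i, c.val i < 2 ^ N}) (R := P.Represents p N)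
    (fun _ _ h _ hR => represents_step hp h hR)
    (fun _ _ _ ⟨_, _, _, hR⟩ => hR ▸ show |p| ≤ B by omega) ⟨t, rfl, hN⟩ ha
  obtain ⟨c, hc, htape, houtput⟩ := exists_halted_output ((getElem?_clamp P _).trans hP) hT hp
  exact ⟨c, hc, hval ▸ htape, hinput.trans (hrun.trans houtput)⟩

end CounterProgram

theorem exists_eval_lt_two_pow (q : Polynomial ℕ) :
    ∃ C, ∀ m : ℕ, q.eval m < 2 ^ (C * (m.bits.length + 1)) := by
  induction q using Polynomial.induction_on with
  | C a =>
    refine ⟨a, fun m => ?_⟩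
    rw [Polynomial.eval_C]
    exact Nat.lt_two_pow_self.trans_le (Nat.pow_le_pow_right two_pos (by nlinarith))
  | add p q hp hq =>
    obtain ⟨C, hC⟩ := hp
    obtain ⟨D, hD⟩ := hq
    refine ⟨C + D + 1, fun m => ?_⟩
    rw [Polynomial.eval_add]
    calc p.eval m + q.eval m
        < 2 ^ ((C + D) * (m.bits.length + 1)) + 2 ^ ((C + D) * (m.bits.length + 1)) :=
          add_lt_add ((hC m).trans_le (by gcongr <;> omega)) ((hD m).trans_le (by gcongr <;> omega))
      _ = 2 ^ ((C + D) * (m.bits.length + 1) + 1) := by ring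
      _ ≤ 2 ^ ((C + D + 1) * (m.bits.length + 1)) :=
          Nat.pow_le_pow_right two_pos (by nlinarith)
  | monomial n a h =>
    obtain ⟨C, hC⟩ := h
    refine ⟨C + 1, fun m => ?_⟩
    rw [pow_succ, ← mul_assoc, Polynomial.eval_mul, Polynomial.eval_X, add_one_mul, pow_add]
    exact Nat.mul_lt_mul'' (hC m)
      ((lt_two_pow_length_bits m).trans (Nat.pow_lt_pow_succ one_lt_two))

theorem TuringLinearSpace.of_threeCounterPolyTime {f : ℕ → ℕ → ℕ} (hf : ThreeCounterPolyTime f) :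
    TuringLinearSpace f := by
  obtain ⟨P, p, hP⟩ := hf
  obtain ⟨C, hC⟩ := exists_eval_lt_two_pow (Polynomial.X + p)
  refine ⟨P.trackMachine, C + 3, fun x y => ?_⟩
  obtain ⟨t, ht, hhalt, hval⟩ := hP x y
  have hlen := length_pairInput x y
  set n := (pairInput x y).length
  have hmax : (max x y).bits.length + 1 ≤ n := by
    rcases max_choice x y with h | h <;> rw [h] <;> omega
  have hN : ∀ s ≤ t, ∀ i, (P.step^[s] ⟨0, ![x, y, 0]⟩).val i < 2 ^ (C * n) := fun s hs i => by
    calc (P.step^[s] ⟨0, ![x, y, 0]⟩).val i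
        ≤ max x y + s := P.iterate_step_val_le (fun i => by fin_cases i <;> simp) s i
      _ ≤ (Polynomial.X + p).eval (max x y) := by
          rw [Polynomial.eval_add, Polynomial.eval_X]; omega
      _ < 2 ^ (C * ((max x y).bits.length + 1)) := hC _
      _ ≤ 2 ^ (C * n) := by gcongr; omega
  obtain ⟨c, hc, htape, hreach⟩ := P.exists_trackMachine_output (N := (C + 1) * n)
    (B := (C + 3) * n) (by nlinarith) (by nlinarith)
    (fun s hs i => (hN s hs i).trans_le (by gcongr <;> omega)) hhalt (by nlinarith)
  have hspace := hreach.forall_iterate_mem hc.step_eq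
  obtain ⟨T, rfl, -⟩ := hreach
  exact ⟨⟨T, hc, hval ▸ htape⟩, hspace⟩
/-! ### Counter machines with arbitrary control states -/

/-- An instruction of a `k` counter machine that names the control states it leads to. In
`dec i q z` the control passes to `z` if counter `i` is zero, and to `q` otherwise. -/
inductive FlowInstr (k : ℕ) (Q : Type*)
  | inc (i : Fin k) (q : Q)
  | dec (i : Fin k) (q z : Q)
  | goto (q : Q)
  | halt

namespace FlowInstr

open Function

variable {k : ℕ} {Q : Type*} {n V : ℕ}

/-- One step of the counter machine that executes the instruction `G q` in the control state `q`. -/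
def step (G : Q → FlowInstr k Q) (c : Q × (Fin k → ℕ)) : Q × (Fin k → ℕ) :=
  match G c.1 with
  | .inc i q => (q, update c.2 i (c.2 i + 1))
  | .dec i q z => if 0 < c.2 i then (q, update c.2 i (c.2 i - 1)) else (z, c.2)
  | .goto q => (q, c.2)
  | .halt => c

/-- The configurations with all counters at most `V`. -/
def bounded (k : ℕ) (Q : Type*) (V : ℕ) : Set (Q × (Fin k → ℕ)) := {c | ∀ i, c.2 i ≤ V}

/-- The first of the two lines that the compiled program reserves for the control state `q`. -/
def addr (e : Q ≃ Fin n) (q : Q) : ℕ := e q * 2 + 1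

/-- The two program lines that carry out an instruction. -/
def lines (e : Q ≃ Fin n) : FlowInstr k Q → Fin 2 → CounterInstr k
  | .inc i q => ![.inc i, .jump (addr e q)]
  | .dec i q z => ![.dec i (addr e z), .jump (addr e q)]
  | .goto q => ![.jump (addr e q), .halt]
  | .halt => ![.halt, .halt]

/-- The program with the same behaviour as the machine with instructions `G` started in `q₀`. -/
def compile (e : Q ≃ Fin n) (G : Q → FlowInstr k Q) (q₀ : Q) : CounterProgram k :=
  .jump (addr e q₀) :: List.ofFn fun j : Fin (n * 2) => lines e (G (e.symm j.divNat)) j.modNat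

variable {e : Q ≃ Fin n} {G : Q → FlowInstr k Q} {q₀ : Q}

theorem addr_lt (e : Q ≃ Fin n) (q : Q) : addr e q + 1 < 2 * n + 1 := by
  unfold addr
  omega

theorem getElem?_compile (q : Q) (j : Fin 2) :
    (compile e G q₀)[addr e q + j]? = some (lines e (G q) j) := by
  have hlt : (e q : ℕ) * 2 + j < n * 2 := by omega
  have hdiv : (⟨e q * 2 + j, hlt⟩ : Fin (n * 2)).divNat = e q := by
    ext
    simp only [Fin.divNat]
    omega
  have hmod : (⟨e q * 2 + j, hlt⟩ : Fin (n * 2)).modNat = j := by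
    ext
    simp only [Fin.modNat]
    omega
  rw [compile, show addr e q + j = e q * 2 + j + 1 from add_right_comm _ _ _,
    List.getElem?_cons_succ, List.getElem?_ofFn, dif_pos hlt, hdiv, hmod, e.symm_apply_apply]

theorem step_compile (q : Q) (j : Fin 2) (v : Fin k → ℕ) :
    (compile e G q₀).step ⟨addr e q + j, v⟩ = match lines e (G q) j with
      | .inc i => ⟨addr e q + j + 1, update v i (v i + 1)⟩
      | .dec i target =>
        if 0 < v i then ⟨addr e q + j + 1, update v i (v i - 1)⟩ else ⟨target, v⟩
      | .jump target => ⟨target, v⟩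
      | .halt => ⟨addr e q + j, v⟩ := by
  simp only [CounterProgram.step, getElem?_compile]
  cases lines e (G q) j <;> rfl

/-- The configurations of a program with `2 * n + 1` lines that have all counters at most `V`. -/
noncomputable def boundedConfigs (k n V : ℕ) : Finset (CounterConfig k) :=
  open Classical in
  (Finset.range (2 * n + 1) ×ˢ Fintype.piFinset fun _ => Finset.range (V + 1)).image
    fun c => ⟨c.1, c.2⟩

theorem mem_boundedConfigs {pc : ℕ} {v : Fin k → ℕ} :
    ⟨pc, v⟩ ∈ boundedConfigs k n V ↔ pc < 2 * n + 1 ∧ ∀ i, v i ≤ V := by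
  simp [boundedConfigs]

theorem card_boundedConfigs_le (k n V : ℕ) :
    (boundedConfigs k n V).card ≤ (2 * n + 1) * (V + 1) ^ k := by
  classical
  exact Finset.card_image_le.trans (by simp)

theorem reaches_compile_step {c : Q × (Fin k → ℕ)} (hc : c ∈ bounded k Q V)
    (hc' : step G c ∈ bounded k Q V) :
    Reaches (compile e G q₀).step (boundedConfigs k n V : Set (CounterConfig k))
      ⟨addr e c.1, c.2⟩ ⟨addr e (step G c).1, (step G c).2⟩ := by
  obtain ⟨q, v⟩ := c
  have mem_first {q : Q} {v : Fin k → ℕ} (h : (q, v) ∈ bounded k Q V) :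
      ⟨addr e q, v⟩ ∈ (boundedConfigs k n V : Set (CounterConfig k)) :=
    mem_boundedConfigs.2 ⟨(Nat.lt_succ_self _).trans (addr_lt e q), h⟩
  have mem_second {q' : Q} {v : Fin k → ℕ} (h : (q', v) ∈ bounded k Q V) :
      ⟨addr e q + 1, v⟩ ∈ (boundedConfigs k n V : Set (CounterConfig k)) :=
    mem_boundedConfigs.2 ⟨addr_lt e q, h⟩
  have first := step_compile (e := e) (G := G) (q₀ := q₀) q 0 v
  have second := step_compile (e := e) (G := G) (q₀ := q₀) q 1
  simp only [Fin.val_zero, Fin.val_one, add_zero] at first second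
  refine Reaches.head (mem_first hc) ?_
  rw [first]
  cases hq : G q with
  | inc i q' =>
    simp only [step, hq, lines] at hc' second ⊢
    exact Reaches.single (mem_second hc') (mem_first hc') (second _)
  | dec i q' z =>
    by_cases hv : 0 < v i <;> simp only [step, hq, lines, hv, if_true, if_false] at hc' second ⊢
    · simp only [Matrix.cons_val_zero, if_pos hv]
      exact Reaches.single (mem_second hc') (mem_first hc') (second _)
    · simp only [Matrix.cons_val_zero, if_neg hv]
      exact Reaches.refl (mem_first hc')
  | goto q' =>
    simp only [step, hq, lines] at hc' ⊢
    exact Reaches.refl (mem_first hc')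
  | halt =>
    simp only [step, hq, lines] at hc' ⊢
    exact Reaches.refl (mem_first hc')

theorem exists_le_halted_compile {v w : Fin k → ℕ} {q : Q} (hq : G q = .halt)
    (h : Reaches (step G) (bounded k Q V) (q₀, v) (q, w)) :
    ∃ t ≤ (2 * n + 1) * (V + 1) ^ k,
      (compile e G q₀).Halted ((compile e G q₀).step^[t] ⟨0, v⟩) ∧
      ((compile e G q₀).step^[t] ⟨0, v⟩).val = w := by
  obtain ⟨_, rfl, hrun⟩ := Reaches.simulate (T := bounded k Q V)
    (S := (boundedConfigs k n V : Set (CounterConfig k)))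
    (R := fun c d => d = (⟨addr e c.1, c.2⟩ : CounterConfig k))
    (fun c hc hc' _ hd => ⟨_, rfl, hd ▸ reaches_compile_step (q₀ := q₀) hc hc'⟩)
    (fun c hc _ hd => hd ▸
      mem_boundedConfigs.2 ⟨(Nat.lt_succ_self _).trans (addr_lt e c.1), hc⟩) h rfl
  have start : ⟨0, v⟩ ∈ (boundedConfigs k n V : Set (CounterConfig k)) :=
    mem_boundedConfigs.2 ⟨Nat.succ_pos _, h.left_mem⟩
  obtain ⟨t, ht, heq⟩ := (Reaches.head start hrun).exists_le_card
  refine ⟨t, ht.trans (card_boundedConfigs_le k n V), ?_, congrArg CounterConfig.val heq⟩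
  simpa [heq, CounterProgram.Halted, hq, lines] using
    getElem?_compile (e := e) (G := G) (q₀ := q₀) q 0

variable {v : Fin k → ℕ} {q q' z : Q} {i : Fin k} {b : Q × (Fin k → ℕ)}

theorem reaches_inc (hq : G q = .inc i q') (hv : (q, v) ∈ bounded k Q V)
    (h : Reaches (step G) (bounded k Q V) (q', update v i (v i + 1)) b) :
    Reaches (step G) (bounded k Q V) (q, v) b :=
  Reaches.head hv (by simpa only [step, hq])

theorem reaches_dec (hq : G q = .dec i q' z) (hi : 0 < v i) (hv : (q, v) ∈ bounded k Q V)
    (h : Reaches (step G) (bounded k Q V) (q', update v i (v i - 1)) b) :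
    Reaches (step G) (bounded k Q V) (q, v) b :=
  Reaches.head hv (by simpa only [step, hq, hi, if_true])

theorem reaches_dec_zero (hq : G q = .dec i q' z) (hi : v i = 0) (hv : (q, v) ∈ bounded k Q V)
    (h : Reaches (step G) (bounded k Q V) (z, v) b) :
    Reaches (step G) (bounded k Q V) (q, v) b :=
  Reaches.head hv (by simpa only [step, hq, hi, lt_irrefl, if_false])

theorem reaches_goto (hq : G q = .goto q') (hv : (q, v) ∈ bounded k Q V)
    (h : Reaches (step G) (bounded k Q V) (q', v) b) :
    Reaches (step G) (bounded k Q V) (q, v) b :=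
  Reaches.head hv (by simpa only [step, hq])

end FlowInstr
/-! ### Counters as stacks -/

/-- An instruction for two counters that are viewed as stacks of digits; `s = false` stands for
counter `0` and `s = true` for counter `1`. The argument `b` is the largest digit, so that the base
`b + 1` is positive. -/
inductive StackInstr (K : ℕ) (Q : Type*)
  /-- push the digit `d`: replace the value `A` of the counter by `(b + 1) * A + d` -/
  | push (s : Bool) (b d : Fin (K + 1)) (q : Q)
  /-- pop the last digit `d` and continue with `next d` -/
  | pop (s : Bool) (b : Fin (K + 1)) (next : Fin (K + 1) → Q)
  /-- continue with `z` if the counter is zero and with `q` otherwise -/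
  | test (s : Bool) (z q : Q)
  | halt

namespace StackInstr

/-- The phases in which a stack instruction is carried out; each of them keeps a digit in the
control state. -/
inductive Phase (K : ℕ) : Type
  | start (r : Fin (K + 1))
  | fill (r : Fin (K + 1))
  | add (r : Fin (K + 1))
  | copy (r : Fin (K + 1))
  | restore (r : Fin (K + 1))
  deriving Fintype

open FlowInstr Function

variable {K V : ℕ} {Q : Type*}

/-- The implementation of stack instructions on three counters, the last of which is auxiliary. -/
def expand (G : Q → StackInstr K Q) (c : Q × Phase K) : FlowInstr 3 (Q × Phase K) :=
  let counter (s : Bool) : Fin 3 := if s then 1 else 0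
  match G c.1, c.2 with
  | .push s b d _, .start _ => .dec (counter s) (c.1, .fill b) (c.1, .add d)
  | .push _ _ _ _, .fill r =>
    .inc 2 (Fin.cases (c.1, .start 0) (fun j => (c.1, .fill j.castSucc)) r)
  | .push _ _ _ _, .add r =>
    Fin.cases (.goto (c.1, .copy 0)) (fun j => .inc 2 (c.1, .add j.castSucc)) r
  | .push _ _ _ q, .copy r => .dec 2 (c.1, .restore r) (q, .start 0)
  | .push s _ _ _, .restore r => .inc (counter s) (c.1, .copy r)
  | .pop s b _, .start r =>
    .dec (counter s) (if r < b then (c.1, .start (r + 1)) else (c.1, .fill 0)) (c.1, .copy r)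
  | .pop _ _ _, .fill _ => .inc 2 (c.1, .start 0)
  | .pop _ _ next, .copy r => .dec 2 (c.1, .restore r) (next r, .start 0)
  | .pop s _ _, .restore r => .inc (counter s) (c.1, .copy r)
  | .test s z _, .start _ => .dec (counter s) (c.1, .restore 0) (z, .start 0)
  | .test s _ q, .restore _ => .inc (counter s) (q, .start 0)
  | _, _ => .halt

/-- Counter contents with `A` in the counter `s`, `B` in the other one of the first two counters
and `C` in the auxiliary counter. -/
def regs (s : Bool) (A B C : ℕ) : Fin 3 → ℕ := if s then ![B, A, C] else ![A, B, C]

/-- The configuration before a stack instruction in the control state `q`, with `A` in the counter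
`s` and `B` in the other counter. -/
def config (K : ℕ) (q : Q) (s : Bool) (A B : ℕ) :
    (Q × Phase K) × (Fin 3 → ℕ) :=
  ((q, .start 0), regs s A B 0)

/-- Reachability with all counters at most `V`. -/
abbrev Run (G : Q → StackInstr K Q) (V : ℕ) (a b : (Q × Phase K) × (Fin 3 → ℕ)) :
    Prop :=
  Reaches (step (expand G)) (bounded 3 _ V) a b

variable {G : Q → StackInstr K Q} {q q' z : Q} {s : Bool} {A B C : ℕ} {b d : Fin (K + 1)}

theorem regs_not : regs (!s) A B C = regs s B A C := by
  cases s <;> rfl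

theorem regs_counter : regs s A B C (if s then 1 else 0) = A := by
  cases s <;> rfl

theorem regs_two : regs s A B C 2 = C := by
  cases s <;> rfl

theorem update_regs_counter (A' : ℕ) :
    update (regs s A B C) (if s then 1 else 0) A' = regs s A' B C := by
  funext i
  cases s <;> fin_cases i <;> simp [regs]

theorem update_regs_two (C' : ℕ) : update (regs s A B C) 2 C' = regs s A B C' := by
  funext i
  cases s <;> fin_cases i <;> simp [regs]

theorem regs_mem_bounded {R : Type*} (r : R) (hA : A ≤ V) (hB : B ≤ V) (hC : C ≤ V) :
    (r, regs s A B C) ∈ bounded 3 R V := by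
  intro i
  cases s <;> fin_cases i <;> simpa [regs]

section Loops

variable {R : Type*} {F : R → FlowInstr 3 R} {r r' r'' : R} {w : R × (Fin 3 → ℕ)}

theorem reaches_inc_counter (hr : F r = .inc (if s then 1 else 0) r') (hA : A ≤ V) (hB : B ≤ V)
    (hC : C ≤ V) (h : Reaches (step F) (bounded 3 R V) (r', regs s (A + 1) B C) w) :
    Reaches (step F) (bounded 3 R V) (r, regs s A B C) w :=
  reaches_inc hr (regs_mem_bounded r hA hB hC) (by rwa [regs_counter, update_regs_counter])

theorem reaches_inc_two (hr : F r = .inc 2 r') (hA : A ≤ V) (hB : B ≤ V)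
    (hC : C ≤ V) (h : Reaches (step F) (bounded 3 R V) (r', regs s A B (C + 1)) w) :
    Reaches (step F) (bounded 3 R V) (r, regs s A B C) w :=
  reaches_inc hr (regs_mem_bounded r hA hB hC) (by rwa [regs_two, update_regs_two])

theorem reaches_dec_counter (hr : F r = .dec (if s then 1 else 0) r' r'') (hA : A + 1 ≤ V)
    (hB : B ≤ V) (hC : C ≤ V) (h : Reaches (step F) (bounded 3 R V) (r', regs s A B C) w) :
    Reaches (step F) (bounded 3 R V) (r, regs s (A + 1) B C) w :=
  reaches_dec hr (by simp [regs_counter]) (regs_mem_bounded r hA hB hC)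
    (by rwa [regs_counter, update_regs_counter])

theorem reaches_dec_two (hr : F r = .dec 2 r' r'') (hA : A ≤ V)
    (hB : B ≤ V) (hC : C + 1 ≤ V) (h : Reaches (step F) (bounded 3 R V) (r', regs s A B C) w) :
    Reaches (step F) (bounded 3 R V) (r, regs s A B (C + 1)) w :=
  reaches_dec hr (by simp [regs_two]) (regs_mem_bounded r hA hB hC)
    (by rwa [regs_two, update_regs_two])

theorem reaches_copy (hr : F r = .dec 2 r' r'') (hr' : F r' = .inc (if s then 1 else 0) r)
    (hAC : A + C ≤ V) (hB : B ≤ V) :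
    Reaches (step F) (bounded 3 R V) (r, regs s A B C) (r'', regs s (A + C) B 0) := by
  induction C generalizing A with
  | zero =>
    have hmem {r : R} := regs_mem_bounded (s := s) r hAC hB (Nat.zero_le V)
    exact reaches_dec_zero hr regs_two hmem (Reaches.refl hmem)
  | succ C ih =>
    refine reaches_dec_two hr (by omega) hB (by omega) ?_
    refine reaches_inc_counter hr' (by omega) hB (by omega) ?_
    rw [← add_assoc, add_right_comm]
    exact ih (by omega)

theorem reaches_add (f : Fin (K + 1) → R) (hzero : F (f 0) = .goto r)
    (hsucc : ∀ j : Fin K, F (f j.succ) = .inc 2 (f j.castSucc)) (j : Fin (K + 1)) (hA : A ≤ V)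
    (hB : B ≤ V) (hC : C + j ≤ V) :
    Reaches (step F) (bounded 3 R V) (f j, regs s A B C) (r, regs s A B (C + j)) := by
  induction j using Fin.induction generalizing C with
  | zero =>
    have hmem {r : R} := regs_mem_bounded (s := s) r hA hB hC
    exact reaches_goto hzero hmem (Reaches.refl hmem)
  | succ j ih =>
    simp only [Fin.val_succ, Fin.val_castSucc] at hC ih ⊢
    refine reaches_inc_two (hsucc j) hA hB (by omega) ?_
    rw [← add_assoc, add_right_comm]
    exact ih (by omega)

end Loops

theorem reaches_fill (hq : G q = .push s b d q') (j : Fin (K + 1)) (hA : A ≤ V) (hB : B ≤ V)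
    (hC : C + (j + 1) ≤ V) :
    Run G V ((q, .fill j), regs s A B C) ((q, .start 0), regs s A B (C + (j + 1))) := by
  induction j using Fin.induction generalizing C with
  | zero =>
    exact reaches_inc_two (by simp only [expand, hq, Fin.cases_zero]) hA hB (by omega)
      (Reaches.refl (regs_mem_bounded _ hA hB hC))
  | succ j ih =>
    simp only [Fin.val_succ, Fin.val_castSucc] at hC ih ⊢
    refine reaches_inc_two (by simp only [expand, hq, Fin.cases_succ]; rfl) hA hB (by omega) ?_
    rw [← add_assoc C, add_right_comm C]
    exact ih (by omega)

theorem reaches_multiply (hq : G q = .push s b d q') (hV : C + (b + 1) * A ≤ V) (hB : B ≤ V) :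
    Run G V ((q, .start 0), regs s A B C) ((q, .add d), regs s 0 B (C + (b + 1) * A)) := by
  induction A generalizing C with
  | zero =>
    have hmem {r : Q × Phase K} := regs_mem_bounded (s := s) r (Nat.zero_le V) hB hV
    exact reaches_dec_zero (by simp only [expand, hq]; rfl) regs_counter hmem (Reaches.refl hmem)
  | succ A ih =>
    have hA : A + 1 ≤ V := by nlinarith
    rw [mul_add, mul_one] at hV
    refine reaches_dec_counter (by simp only [expand, hq]; rfl) hA hB (by omega) ?_
    refine (reaches_fill hq b (by omega) hB (by omega)).trans ?_
    rw [show C + (b + 1) * (A + 1) = C + (b + 1) + (b + 1) * A by ring]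
    exact ih (by omega)

theorem run_push (hq : G q = .push s b d q') (hV : (b + 1) * A + d ≤ V) (hB : B ≤ V) :
    Run G V (config K q s A B) (config K q' s ((b + 1) * A + d) B) := by
  have multiply := reaches_multiply (A := A) (C := 0) (V := V) hq (by omega) hB
  have add := reaches_add (F := expand G) (s := s) (V := V) (A := 0) (B := B)
    (C := (b + 1) * A) (r := (q, .copy 0)) (fun j => (q, .add j))
    (by simp only [expand, hq, Fin.cases_zero]) (fun j => by simp only [expand, hq, Fin.cases_succ])
    d (Nat.zero_le V) hB hV
  have copy := reaches_copy (F := expand G) (s := s) (V := V) (A := 0) (B := B)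
    (C := (b + 1) * A + d) (r := (q, .copy 0)) (by simp only [expand, hq]; rfl)
    (by simp only [expand, hq]) (by omega) hB
  rw [zero_add] at multiply copy
  exact multiply.trans (add.trans copy)

theorem reaches_count {next : Fin (K + 1) → Q} (hq : G q = .pop s b next) (hd : d ≤ b)
    (hA : A + d ≤ V) (hB : B ≤ V) (hC : C ≤ V) :
    Run G V ((q, .start 0), regs s (A + d) B C) ((q, .start d), regs s A B C) := by
  induction d using Fin.induction generalizing A with
  | zero => exact Reaches.refl (regs_mem_bounded _ hA hB hC)
  | succ d ih =>
    have hlt : d.castSucc < b := Fin.castSucc_lt_succ.trans_le hd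
    simp only [Fin.val_succ, Fin.val_castSucc] at hA ih ⊢
    rw [← add_assoc, add_right_comm]
    refine (ih hlt.le (by omega)).trans ?_
    refine reaches_dec_counter (by simp only [expand, hq]; rfl) (by omega) hB hC ?_
    rw [if_pos hlt, Fin.coeSucc_eq_succ]
    exact Reaches.refl (regs_mem_bounded _ (by omega) hB hC)

theorem reaches_divide {next : Fin (K + 1) → Q} (hq : G q = .pop s b next) (hd : d ≤ b)
    (hV : (b + 1) * A + d + C ≤ V) (hB : B ≤ V) :
    Run G V ((q, .start 0), regs s ((b + 1) * A + d) B C) ((q, .copy d), regs s 0 B (C + A)) := by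
  induction A generalizing C with
  | zero =>
    have hmem {r : Q × Phase K} :=
      regs_mem_bounded (s := s) (C := C) r (Nat.zero_le V) hB (by omega)
    rw [mul_zero] at hV ⊢
    refine (reaches_count hq hd (by omega) hB (by omega)).trans ?_
    exact reaches_dec_zero (by simp only [expand, hq]; rfl) regs_counter hmem (Reaches.refl hmem)
  | succ A ih =>
    rw [mul_add, mul_one] at hV
    rw [show (b + 1) * (A + 1) + d = (b + 1) * A + d + 1 + b by ring]
    refine (reaches_count hq le_rfl (by omega) hB (by omega)).trans ?_
    refine reaches_dec_counter (by simp only [expand, hq]; rfl) (by omega) hB (by omega) ?_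
    rw [if_neg (lt_irrefl b)]
    refine reaches_inc_two (by simp only [expand, hq]; rfl) (by omega) hB (by omega) ?_
    rw [add_comm A, ← add_assoc]
    exact ih (by omega)

theorem run_pop {next : Fin (K + 1) → Q} (hq : G q = .pop s b next) (hd : d ≤ b)
    (hV : (b + 1) * A + d ≤ V) (hB : B ≤ V) :
    Run G V (config K q s ((b + 1) * A + d) B) (config K (next d) s A B) := by
  have divide := reaches_divide (C := 0) hq hd hV hB
  have copy := reaches_copy (F := expand G) (s := s) (V := V) (A := 0) (B := B) (C := A)
    (r := (q, .copy d)) (by simp only [expand, hq]; rfl) (by simp only [expand, hq])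
    (by nlinarith) hB
  rw [zero_add] at divide copy
  exact divide.trans copy

theorem run_test_zero (hq : G q = .test s z q') (hB : B ≤ V) :
    Run G V (config K q s 0 B) (config K z s 0 B) := by
  have hmem {r : Q × Phase K} := regs_mem_bounded (s := s) r (Nat.zero_le V) hB (Nat.zero_le V)
  exact reaches_dec_zero (by simp only [expand, hq]; rfl) regs_counter hmem (Reaches.refl hmem)

theorem run_test_pos (hq : G q = .test s z q') (hA : 0 < A) (hV : A ≤ V) (hB : B ≤ V) :
    Run G V (config K q s A B) (config K q' s A B) := by
  obtain ⟨A, rfl⟩ := Nat.exists_eq_add_of_lt hA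
  rw [zero_add] at hV ⊢
  refine reaches_dec_counter (by simp only [expand, hq]; rfl) hV hB (Nat.zero_le V) ?_
  refine reaches_inc_counter (by simp only [expand, hq]; rfl) (by omega) hB (Nat.zero_le V) ?_
  exact Reaches.refl (regs_mem_bounded _ hV hB (Nat.zero_le V))

end StackInstr
/-! ### Tapes as pairs of stacks -/

section Stacks

variable {K m n : ℕ}

/-- The stack `n` of digits in base `K + 1` with the digit `d` pushed on top. -/
def pushDigit (d : Fin (K + 1)) (n : ℕ) : ℕ := (K + 1) * n + d

/-- The stack `n` with the digits `l` on top, the first one topmost. -/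
def pushDigits (l : List (Fin (K + 1))) (n : ℕ) : ℕ := l.foldr pushDigit n

theorem pushDigit_zero_zero : pushDigit (0 : Fin (K + 1)) 0 = 0 := rfl

theorem pushDigits_append (l l' : List (Fin (K + 1))) (n : ℕ) :
    pushDigits (l ++ l') n = pushDigits l (pushDigits l' n) :=
  List.foldr_append

theorem le_pow_of_lt_pow {N : ℕ} (hn : n < (K + 1) ^ m) (hm : m ≤ N) : n ≤ (K + 1) ^ N :=
  hn.le.trans (Nat.pow_le_pow_right K.succ_pos hm)

theorem lt_pow_length_bits (K n : ℕ) : n < (K + 2) ^ n.bits.length :=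
  (lt_two_pow_length_bits n).trans_le (Nat.pow_le_pow_left (by omega) _)

theorem le_pushDigit (d : Fin (K + 1)) (n : ℕ) : n ≤ pushDigit d n := by
  rw [pushDigit]
  nlinarith

theorem le_pushDigits (l : List (Fin (K + 1))) (n : ℕ) : n ≤ pushDigits l n := by
  induction l with
  | nil => exact le_rfl
  | cons d l ih => exact ih.trans (le_pushDigit d _)

theorem pushDigit_lt_pow (d : Fin (K + 1)) (hn : n < (K + 1) ^ m) :
    pushDigit d n < (K + 1) ^ (m + 1) :=
  calc (K + 1) * n + d < (K + 1) * (n + 1) := by rw [mul_add, mul_one]; omega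
    _ ≤ (K + 1) * (K + 1) ^ m := Nat.mul_le_mul_left _ hn
    _ = (K + 1) ^ (m + 1) := (pow_succ' _ _).symm

theorem lt_pow_of_pushDigit_lt_pow {d : Fin (K + 1)} (h : pushDigit d n < (K + 1) ^ m) :
    n < (K + 1) ^ (m - 1) := by
  cases m with
  | zero => exact (le_pushDigit d n).trans_lt h
  | succ m =>
    rw [pow_succ', pushDigit] at h
    exact Nat.lt_of_mul_lt_mul_left (Nat.lt_of_add_right_lt h)

theorem pushDigits_lt_pow (l : List (Fin (K + 1))) (hn : n < (K + 1) ^ m) :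
    pushDigits l n < (K + 1) ^ (m + l.length) := by
  induction l with
  | nil => exact hn
  | cons d l ih => exact pushDigit_lt_pow d ih

theorem two_pow_length_le_pushDigits {l : List (Fin (K + 1))} (hl : 0 ∉ l) :
    2 ^ l.length ≤ pushDigits l 0 + 1 := by
  induction l with
  | nil => exact le_rfl
  | cons d l ih =>
    rw [List.mem_cons, not_or] at hl
    have hd : 0 < (d : ℕ) := Fin.pos_iff_ne_zero.2 (Ne.symm hl.1)
    have hK : 1 ≤ K := hd.trans_le d.is_le
    calc 2 ^ (l.length + 1) ≤ 2 * pushDigits l 0 + 2 := by rw [pow_succ]; linarith [ih hl.2]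
      _ ≤ pushDigit d (pushDigits l 0) + 1 := by rw [pushDigit]; nlinarith

variable {Γ : Type*} [Inhabited Γ] {code : Γ ≃ Fin (K + 1)}

/-- The number whose digits, from the last one on, are the symbols on the half-tape. The blank
symbol has to be the digit zero. -/
def stackValue (h₀ : code default = 0) (L : ListBlank Γ) : ℕ :=
  L.liftOn (fun l => pushDigits (l.map code) 0) <| by
    rintro l _ ⟨i, rfl⟩
    have blanks : pushDigits (List.replicate i (0 : Fin (K + 1))) 0 = 0 := by
      induction i with
      | zero => rfl
      | succ i ih => exact (congrArg (pushDigit 0) ih).trans pushDigit_zero_zero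
    rw [List.map_append, pushDigits_append, List.map_replicate, h₀, blanks]

theorem stackValue_mk (h₀ : code default = 0) (l : List Γ) :
    stackValue h₀ (.mk l) = pushDigits (l.map code) 0 :=
  rfl

theorem stackValue_cons (h₀ : code default = 0) (a : Γ) (L : ListBlank Γ) :
    stackValue h₀ (L.cons a) = pushDigit (code a) (stackValue h₀ L) := by
  induction L using ListBlank.induction_on with
  | _ l => rfl

theorem stackValue_cons_lt_pow (h₀ : code default = 0) (a : Γ) {L : ListBlank Γ}
    (hL : stackValue h₀ L < (K + 1) ^ m) : stackValue h₀ (L.cons a) < (K + 1) ^ (m + 1) := by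
  rw [stackValue_cons]
  exact pushDigit_lt_pow _ hL

theorem stackValue_lt_pow_of_cons (h₀ : code default = 0) {a : Γ} {L : ListBlank Γ}
    (hL : stackValue h₀ (L.cons a) < (K + 1) ^ m) : stackValue h₀ L < (K + 1) ^ (m - 1) := by
  rw [stackValue_cons] at hL
  exact lt_pow_of_pushDigit_lt_pow hL

theorem le_stackValue_cons (h₀ : code default = 0) (a : Γ) (L : ListBlank Γ) :
    stackValue h₀ L ≤ stackValue h₀ (L.cons a) := by
  rw [stackValue_cons]
  exact le_pushDigit _ _

end Stacks

namespace StackInstr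

variable {K V : ℕ} {Q : Type*} {G : Q → StackInstr K Q} {q q' : Q} {s : Bool} {A B : ℕ}
  {d : Fin (K + 1)}

theorem config_not : config K q (!s) A B = config K q s B A :=
  congrArg _ regs_not

theorem config_false : config K q false A B = config K q true B A :=
  config_not (s := true)

theorem run_pushDigit (hq : G q = .push s (Fin.last K) d q') (hV : pushDigit d A ≤ V)
    (hB : B ≤ V) : Run G V (config K q s A B) (config K q' s (pushDigit d A) B) :=
  run_push hq hV hB

theorem run_popDigit {next : Fin (K + 1) → Q} (hq : G q = .pop s (Fin.last K) next)
    (hV : pushDigit d A ≤ V) (hB : B ≤ V) :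
    Run G V (config K q s (pushDigit d A) B) (config K (next d) s A B) :=
  run_pop hq d.le_last hV hB

section Symbols

variable {Γ : Type*} [Inhabited Γ] {code : Γ ≃ Fin (K + 1)} {h₀ : code default = 0} {a : Γ}
  {L : ListBlank Γ}

theorem run_pushSymbol (hq : G q = .push s (Fin.last K) (code a) q')
    (hV : stackValue h₀ (L.cons a) ≤ V) (hB : B ≤ V) :
    Run G V (config K q s (stackValue h₀ L) B) (config K q' s (stackValue h₀ (L.cons a)) B) := by
  rw [stackValue_cons] at hV ⊢
  exact run_pushDigit hq hV hB

theorem run_popSymbol {next : Fin (K + 1) → Q} (hq : G q = .pop s (Fin.last K) next)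
    (hV : stackValue h₀ (L.cons a) ≤ V) (hB : B ≤ V) :
    Run G V (config K q s (stackValue h₀ (L.cons a)) B)
      (config K (next (code a)) s (stackValue h₀ L) B) := by
  rw [stackValue_cons] at hV ⊢
  exact run_popDigit hq hV hB

end Symbols

section Bits

variable {G : Q → StackInstr (K + 1) Q}

theorem bit_eq (b : Bool) (n : ℕ) :
    Nat.bit b n = (((1 : Fin (K + 2)) : ℕ) + 1) * n + ((if b then 1 else 0 : Fin (K + 2)) : ℕ) := by
  cases b <;> simp [Nat.bit_val]

theorem run_pushBit (b : Bool) (hq : G q = .push s 1 (if b then 1 else 0) q')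
    (hV : Nat.bit b A ≤ V) (hB : B ≤ V) :
    Run G V (config (K + 1) q s A B) (config (K + 1) q' s (Nat.bit b A) B) := by
  rw [bit_eq (K := K)] at hV ⊢
  exact run_push hq hV hB

theorem run_popBit {next : Fin (K + 2) → Q} (b : Bool) (hq : G q = .pop s 1 next)
    (hV : Nat.bit b A ≤ V) (hB : B ≤ V) :
    Run G V (config (K + 1) q s (Nat.bit b A) B)
      (config (K + 1) (next (if b then 1 else 0)) s A B) := by
  rw [bit_eq (K := K)] at hV ⊢
  refine run_pop hq ?_ hV hB
  split
  · exact le_rfl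
  · exact Fin.zero_le _

end Bits

end StackInstr

/-! ### Simulating a Turing machine with two stacks -/

/-- The control states of the simulation of a Turing machine with states `σ` by two stacks of
digits `δ`. -/
inductive StackState (σ δ : Type) : Type
  | mark
  | testBits (s : Bool)
  | popBit (s : Bool)
  | pushBit (s b : Bool)
  | popBack
  | pushBack (d : δ)
  | pushSep
  | scan (q : σ)
  | push (s : Bool) (d : δ) (q : σ)
  | shift (d : δ) (q : σ)
  | fetch (q : σ)
  | popOutput
  | pushOutput (b : Bool)
  | done
  deriving Fintype

namespace TuringMachine

open StackInstr

variable {M : TuringMachine} {K V N : ℕ} {code : M.Symbol ≃ Fin (K + 2)}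

/-- The digit that stands for a bit on the tape. -/
def bitDigit (code : M.Symbol ≃ Fin (K + 2)) (b : Bool) : Fin (K + 2) :=
  code (M.base (if b then .one else .zero))

/-- The simulation of `M` by two stacks: counter `0` holds the tape to the left of the head and
counter `1` the scanned cell and the tape to the right of it. At first the input is brought from
base `2` to the base of the stacks. For this, the bits of `y` are moved to counter `0`, above a
separator and the number `x`, and back to counter `1`; then the bits of `x` are moved to
counter `1`. -/
def stackProgram (M : TuringMachine) (code : M.Symbol ≃ Fin (K + 2)) :
    StackState M.State (Fin (K + 2)) → StackInstr (K + 1) (StackState M.State (Fin (K + 2)))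
  | .mark => .push false (Fin.last _) (code (M.base .sep)) (.testBits true)
  | .testBits s => .test s (if s then .popBack else .push true 0 M.start) (.popBit s)
  | .popBit s => .pop s 1 fun d => .pushBit s (d == 1)
  | .pushBit s b => .push (!s) (Fin.last _) (bitDigit code b) (.testBits s)
  | .popBack => .pop false (Fin.last _) fun d =>
    if d = code (M.base .sep) then .pushSep else .pushBack d
  | .pushBack d => .push true (Fin.last _) d .popBack
  | .pushSep => .push true (Fin.last _) (code (M.base .sep)) (.testBits false)
  | .scan q => .pop true (Fin.last _) fun d =>
    match M.transition q (code.symm d) with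
    | some (q', a, .left) => .shift (code a) q'
    | some (q', a, .stay) => .push true (code a) q'
    | some (q', a, .right) => .push false (code a) q'
    | none => .popOutput
  | .push s d q => .push s (Fin.last _) d (.scan q)
  | .shift d q => .push true (Fin.last _) d (.fetch q)
  | .fetch q => .pop false (Fin.last _) fun d => .push true d q
  | .popOutput => .pop true (Fin.last _) fun d =>
    if d = bitDigit code false then .pushOutput false
    else if d = bitDigit code true then .pushOutput true
    else .done
  | .pushOutput b => .push false 1 (if b then 1 else 0) .popOutput
  | .done => .halt


theorem run_testBits (s : Bool) {n A : ℕ} (hn : n ≤ V)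
    (hA : pushDigits (n.bits.map (bitDigit code)).reverse A ≤ V) :
    Run (M.stackProgram code) V (config (K + 1) (.testBits s) s n A)
      (config (K + 1) (if s then .popBack else .push true 0 M.start) s 0
        (pushDigits (n.bits.map (bitDigit code)).reverse A)) := by
  induction n using Nat.binaryRec' generalizing A with
  | zero => exact run_test_zero rfl hA
  | bit b n h ih =>
    rw [Nat.bits_append_bit n b h, List.map_cons, List.reverse_cons, pushDigits_append] at hA ⊢
    have hd : pushDigit (bitDigit code b) A ≤ V := (le_pushDigits _ _).trans hA
    have hA' : A ≤ V := (le_pushDigit _ A).trans hd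
    have hn' : n ≤ V := by
      rw [Nat.bit_val] at hn
      omega
    have hpos : 0 < Nat.bit b n := Nat.pos_iff_ne_zero.2 (Nat.bit_ne_zero_iff.2 h)
    have test := run_test_pos (G := M.stackProgram code) (q := .testBits s) rfl hpos hn hA'
    have pop := run_popBit (G := M.stackProgram code) (q := .popBit s) b rfl hn hA'
    rw [show ((if b then 1 else 0 : Fin (K + 2)) == 1) = b by cases b <;> rfl] at pop
    have push := run_pushDigit (G := M.stackProgram code) (q := .pushBit s b) rfl hd hn'
    rw [config_not, config_not] at push
    exact test.trans (pop.trans (push.trans (ih hn' hA)))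

theorem run_popBack {l : List (Fin (K + 2))} (hl : code (M.base .sep) ∉ l) {x B : ℕ}
    (hx : pushDigits l (pushDigit (code (M.base .sep)) x) ≤ V)
    (hB : pushDigits l.reverse B ≤ V) :
    Run (M.stackProgram code) V
      (config (K + 1) .popBack false (pushDigits l (pushDigit (code (M.base .sep)) x)) B)
      (config (K + 1) .pushSep false x (pushDigits l.reverse B)) := by
  induction l generalizing B with
  | nil =>
    have pop := run_popDigit (G := M.stackProgram code) (q := .popBack) rfl hx hB
    rwa [if_pos rfl] at pop
  | cons d l ih =>
    rw [List.mem_cons, not_or] at hl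
    rw [List.reverse_cons, pushDigits_append] at hB ⊢
    have hd : pushDigit d B ≤ V := (le_pushDigits _ _).trans hB
    have hx' := (le_pushDigit d _).trans hx
    have pop := run_popDigit (G := M.stackProgram code) (q := .popBack) rfl hx
      ((le_pushDigit d B).trans hd)
    rw [if_neg (Ne.symm hl.1)] at pop
    have push := run_pushDigit (G := M.stackProgram code) (q := .pushBack d) rfl hd hx'
    exact pop.trans (.trans (config_not ▸ push) (ih hl.2 hx' hB))

theorem run_popOutput {n A : ℕ} (hn : n ≤ V)
    (hA : pushDigits (n.bits.map (bitDigit code)).reverse A ≤ V) :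
    Run (M.stackProgram code) V
      (config (K + 1) .popOutput true (pushDigits (n.bits.map (bitDigit code)).reverse A) 0)
      (config (K + 1) .popOutput true A n) := by
  induction n using Nat.binaryRec' generalizing A with
  | zero => exact Reaches.refl (regs_mem_bounded _ hA hn (Nat.zero_le V))
  | bit b n h ih =>
    rw [Nat.bits_append_bit n b h, List.map_cons, List.reverse_cons, pushDigits_append] at hA ⊢
    have hd : pushDigit (bitDigit code b) A ≤ V := (le_pushDigits _ _).trans hA
    have hA' : A ≤ V := (le_pushDigit _ A).trans hd
    have hn' : n ≤ V := by
      rw [Nat.bit_val] at hn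
      omega
    have pop : Run (M.stackProgram code) V
        (config (K + 1) .popOutput true (pushDigit (bitDigit code b) A) n)
        (config (K + 1) (.pushOutput b) true A n) := by
      have := run_popDigit (G := M.stackProgram code) (q := .popOutput) rfl hd hn'
      cases b <;> simpa [bitDigit] using this
    have push := run_pushBit (G := M.stackProgram code) (q := .pushOutput b) b rfl hn hA'
    exact (ih hn' hA).trans (pop.trans push)


theorem map_code_bin (n : ℕ) :
    ((bin n).map M.base).map code = (n.bits.map (bitDigit code)).reverse := by
  rw [bin, List.map_reverse, List.map_reverse, List.map_map, List.map_map]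
  rfl

theorem stackValue_pairInput (h₀ : code (M.base .blank) = 0) (x y : ℕ) :
    stackValue h₀ (.mk ((pairInput x y).map M.base)) =
      pushDigits (x.bits.map (bitDigit code)).reverse
        (pushDigit (code (M.base .sep)) (pushDigits (y.bits.map (bitDigit code)) 0)) := by
  rw [stackValue_mk, pairInput, List.map_append, List.map_append, pushDigits_append, map_code_bin,
    List.map_cons, List.map_cons, List.map_reverse, List.map_reverse, map_code_bin,
    List.reverse_reverse]
  rfl

theorem run_input_of_le (h₀ : code (M.base .blank) = 0) {x y : ℕ} (hy : y ≤ V)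
    (hyx : pushDigits (y.bits.map (bitDigit code)).reverse (pushDigit (code (M.base .sep)) x) ≤ V)
    (hw : stackValue h₀ ((ListBlank.mk ((pairInput x y).map M.base)).cons (M.base .blank)) ≤ V) :
    Run (M.stackProgram code) V (config (K + 1) .mark false x y)
      (config (K + 1) (.scan M.start) true
        (stackValue h₀ ((ListBlank.mk ((pairInput x y).map M.base)).cons (M.base .blank))) 0) := by
  rw [stackValue_cons, stackValue_pairInput, h₀] at hw ⊢
  have sep_notMem : code (M.base .sep) ∉ (y.bits.map (bitDigit code)).reverse := by
    simp [bitDigit, apply_ite]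
  have hx₁ := (le_pushDigits _ _).trans hyx
  have hx := (le_pushDigit _ _).trans hx₁
  have hw₁ := (le_pushDigit _ _).trans hw
  have hy₁ := (le_pushDigits _ _).trans hw₁
  have mark := run_pushDigit (G := M.stackProgram code) (q := .mark) rfl hx₁ hy
  have moveY := run_testBits true hy hyx
  have moveYBack := run_popBack sep_notMem hyx (B := 0)
    (by rw [List.reverse_reverse]; exact (le_pushDigit _ _).trans hy₁)
  rw [List.reverse_reverse] at moveYBack
  have sep := run_pushDigit (G := M.stackProgram code) (q := .pushSep) rfl hy₁ hx
  have moveX := run_testBits false hx hw₁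
  have blank := run_pushDigit (G := M.stackProgram code) (q := .push true 0 M.start) rfl hw
    (Nat.zero_le _)
  rw [config_false] at mark moveYBack moveX
  exact mark.trans (moveY.trans (moveYBack.trans (sep.trans (moveX.trans blank))))

theorem run_input (h₀ : code (M.base .blank) = 0) {x y : ℕ} (hN : (pairInput x y).length < N) :
    Run (M.stackProgram code) ((K + 2) ^ N) (config (K + 1) .mark false x y)
      (config (K + 1) (.scan M.start) true
        (stackValue h₀ ((ListBlank.mk ((pairInput x y).map M.base)).cons (M.base .blank))) 0) := by
  rw [length_pairInput] at hN
  have hyx := pushDigits_lt_pow (y.bits.map (bitDigit code)).reverse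
    (pushDigit_lt_pow (code (M.base .sep)) (lt_pow_length_bits K x))
  have hw := pushDigit_lt_pow 0 <| pushDigits_lt_pow (x.bits.map (bitDigit code)).reverse <|
    pushDigit_lt_pow (code (M.base .sep)) <|
    pushDigits_lt_pow (m := 0) (n := 0) (y.bits.map (bitDigit code)) Nat.one_pos
  simp only [List.length_map, List.length_reverse] at hyx hw
  refine run_input_of_le h₀ (le_pow_of_lt_pow (lt_pow_length_bits K y) (by omega))
    (le_pow_of_lt_pow hyx (by omega)) ?_
  rw [stackValue_cons, stackValue_pairInput, h₀]
  exact le_pow_of_lt_pow hw (by omega)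

/-- The configuration of `stackProgram` that stands for a configuration of the Turing machine in
the state `q`: the half-tapes `L`, to the left of the head, and `R`, from the scanned cell on, are
on the two stacks. -/
def stackConfig (h₀ : code (M.base .blank) = 0) (q : M.State) (L R : ListBlank M.Symbol) :
    (StackState M.State (Fin (K + 2)) × Phase (K + 1)) × (Fin 3 → ℕ) :=
  config (K + 1) (.scan q) true (stackValue h₀ R) (stackValue h₀ L)

section Step

variable {h₀ : code (M.base .blank) = 0} {q q' : M.State} {a b s : M.Symbol}
  {L R : ListBlank M.Symbol}

theorem run_scan (hL : stackValue h₀ L ≤ V) (hR : stackValue h₀ (R.cons a) ≤ V) :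
    Run (M.stackProgram code) V (stackConfig h₀ q L (R.cons a))
      (config (K + 1)
        (match M.transition q a with
        | some (q', s, .left) => .shift (code s) q'
        | some (q', s, .stay) => .push true (code s) q'
        | some (q', s, .right) => .push false (code s) q'
        | none => .popOutput) true (stackValue h₀ R) (stackValue h₀ L)) := by
  have pop := run_popSymbol (G := M.stackProgram code) (q := .scan q) rfl hR hL
  rwa [code.symm_apply_apply] at pop

theorem run_stay (hq : M.transition q a = some (q', s, .stay)) (hL : stackValue h₀ L ≤ V)
    (hR : stackValue h₀ (R.cons a) ≤ V) (hR' : stackValue h₀ (R.cons s) ≤ V) :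
    Run (M.stackProgram code) V (stackConfig h₀ q L (R.cons a))
      (stackConfig h₀ q' L (R.cons s)) := by
  have scan := run_scan (q := q) hL hR
  rw [hq] at scan
  exact scan.trans (run_pushSymbol rfl hR' hL)

theorem run_right (hq : M.transition q a = some (q', s, .right))
    (hR : stackValue h₀ (R.cons a) ≤ V) (hL' : stackValue h₀ (L.cons s) ≤ V) :
    Run (M.stackProgram code) V (stackConfig h₀ q L (R.cons a))
      (stackConfig h₀ q' (L.cons s) R) := by
  have scan := run_scan (q := q) ((le_stackValue_cons h₀ s L).trans hL') hR
  rw [hq] at scan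
  have push := run_pushSymbol (G := M.stackProgram code) (q := .push false (code s) q') rfl hL'
    ((le_stackValue_cons h₀ a R).trans hR)
  rw [config_false, config_false] at push
  exact scan.trans push

theorem run_left (hq : M.transition q a = some (q', s, .left))
    (hL : stackValue h₀ (L.cons b) ≤ V) (hR : stackValue h₀ (R.cons a) ≤ V)
    (hR' : stackValue h₀ ((R.cons s).cons b) ≤ V) :
    Run (M.stackProgram code) V (stackConfig h₀ q (L.cons b) (R.cons a))
      (stackConfig h₀ q' L ((R.cons s).cons b)) := by
  have hRs := (le_stackValue_cons h₀ b _).trans hR'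
  have scan := run_scan (q := q) hL hR
  rw [hq] at scan
  have shift := run_pushSymbol (G := M.stackProgram code) (q := .shift (code s) q') rfl hRs hL
  have fetch := run_popSymbol (G := M.stackProgram code) (q := .fetch q') rfl hL hRs
  rw [config_false, config_false] at fetch
  exact scan.trans (shift.trans (fetch.trans
    (run_pushSymbol rfl hR' ((le_stackValue_cons h₀ b L).trans hL))))

end Step

/-- The correspondence between a configuration of a Turing machine whose head stays within
distance `D` and one of `stackProgram`. The sizes of the numbers reflect that all cells that are
farther away are blank. -/
def Encodes (h₀ : code (M.base .blank) = 0) (D : ℕ) (c : M.Config)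
    (γ : (StackState M.State (Fin (K + 2)) × Phase (K + 1)) × (Fin 3 → ℕ)) : Prop :=
  ∃ q h L R, c = M.facing q h 1 L R ∧ γ = stackConfig h₀ q L R ∧
    stackValue h₀ L < (K + 2) ^ (D + h).toNat ∧ stackValue h₀ R < (K + 2) ^ (D + 1 - h).toNat

section Simulation

variable {h₀ : code (M.base .blank) = 0} {D : ℕ} {c : M.Config}
  {γ : (StackState M.State (Fin (K + 2)) × Phase (K + 1)) × (Fin 3 → ℕ)}

theorem Encodes.mem_bounded (hc : c ∈ M.within D) (h : Encodes h₀ D c γ) :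
    γ ∈ FlowInstr.bounded 3 _ ((K + 2) ^ (2 * D + 2)) := by
  obtain ⟨q, h, L, R, rfl, rfl, hL, hR⟩ := h
  have hD : |h| ≤ D := hc
  rw [abs_le] at hD
  exact regs_mem_bounded _ (le_pow_of_lt_pow hR (by omega)) (le_pow_of_lt_pow hL (by omega))
    (Nat.zero_le _)

theorem exists_run_step (hc : c ∈ M.within D) (h : Encodes h₀ D c γ) :
    ∃ γ', Encodes h₀ D (M.step c) γ' ∧
      Run (M.stackProgram code) ((K + 2) ^ (2 * D + 2)) γ γ' := by
  have mem := Encodes.mem_bounded hc h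
  obtain ⟨q, p, L, R, rfl, rfl, hL, hR⟩ := id h
  have hp : |p| ≤ D := hc
  rw [abs_le] at hp
  obtain ⟨a, R, rfl⟩ : ∃ a R', R = ListBlank.cons a R' := ⟨_, _, (ListBlank.cons_head_tail R).symm⟩
  have hR' := stackValue_lt_pow_of_cons h₀ hR
  have hV {n m : ℕ} (hn : n < (K + 2) ^ m) (hm : m ≤ 2 * D + 2) : n ≤ (K + 2) ^ (2 * D + 2) :=
    le_pow_of_lt_pow hn hm
  rcases hq : M.transition q a with _ | ⟨q', s, _ | _ | _⟩
  · rw [(halted_facing_iff.2 hq).step_eq]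
    exact ⟨_, h, Reaches.refl mem⟩
  · obtain ⟨b, L, rfl⟩ : ∃ b L', L = ListBlank.cons b L' :=
      ⟨_, _, (ListBlank.cons_head_tail L).symm⟩
    have hRb := stackValue_cons_lt_pow h₀ b (stackValue_cons_lt_pow h₀ s hR')
    rw [step_facing_turn (d := 1) hq, facing_neg]
    refine ⟨_, ⟨q', p - 1, L, _, rfl, rfl, ?_, ?_⟩, run_left hq (hV hL (by omega))
      (hV hR (by omega)) (hV hRb (by omega))⟩
    · convert stackValue_lt_pow_of_cons h₀ hL using 2
      omega
    · convert hRb using 2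
      omega
  · have hRs := stackValue_cons_lt_pow h₀ s hR'
    rw [step_facing_stay hq]
    refine ⟨_, ⟨q', p, L, _, rfl, rfl, hL, ?_⟩, run_stay hq (hV hL (by omega)) (hV hR (by omega))
      (hV hRs (by omega))⟩
    convert hRs using 2
    omega
  · have hLs := stackValue_cons_lt_pow h₀ s hL
    rw [step_facing_forward (d := 1) hq]
    refine ⟨_, ⟨q', p + 1, _, R, rfl, rfl, ?_, ?_⟩, run_right hq (hV hR (by omega))
      (hV hLs (by omega))⟩
    · convert hLs using 2
      omega
    · convert hR' using 2
      omega

end Simulation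

theorem le_pushDigits_bits (h₀ : code (M.base .blank) = 0) (n : ℕ) :
    n ≤ pushDigits (n.bits.map (bitDigit code)).reverse 0 := by
  have ne_zero : 0 ∉ (n.bits.map (bitDigit code)).reverse := by
    simp [bitDigit, ← h₀, apply_ite]
  have h := two_pow_length_le_pushDigits ne_zero
  rw [List.length_reverse, List.length_map] at h
  exact Nat.lt_succ_iff.1 ((lt_two_pow_length_bits n).trans_le h)

theorem run_output (h₀ : code (M.base .blank) = 0) {q : M.State} {v : ℕ}
    (hq : M.transition q (M.base .blank) = none)
    (hV : stackValue h₀ ((ListBlank.mk ((bin v).map M.base)).cons (M.base .blank)) ≤ V) :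
    Run (M.stackProgram code) V
      (stackConfig h₀ q ∅ ((ListBlank.mk ((bin v).map M.base)).cons (M.base .blank)))
      (config (K + 1) .done true 0 v) := by
  have scan := run_scan (h₀ := h₀) (q := q) (L := ∅) (Nat.zero_le V) hV
  rw [hq] at scan
  replace hV := (le_stackValue_cons h₀ _ _).trans hV
  rw [stackValue_mk, map_code_bin] at hV scan
  have hv : v ≤ V := (le_pushDigits_bits h₀ v).trans hV
  have pop := run_popDigit (G := M.stackProgram code) (q := .popOutput) (s := true) (d := 0)
    (A := 0) rfl (Nat.zero_le V) hv
  rw [if_neg (by simp [bitDigit, ← h₀]), if_neg (by simp [bitDigit, ← h₀])] at pop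
  exact scan.trans ((run_popOutput hv hV).trans pop)

theorem run_stackProgram (h₀ : code (M.base .blank) = 0) {x y v t D : ℕ}
    (hD : (pairInput x y).length ≤ D)
    (hhalt : M.Halted (M.step^[t] (M.init (pairInput x y))))
    (htape : (M.step^[t] (M.init (pairInput x y))).tape =
      M.tapeOf (M.step^[t] (M.init (pairInput x y))).head (bin v))
    (hspace : ∀ s, M.step^[s] (M.init (pairInput x y)) ∈ M.within D) :
    Run (M.stackProgram code) ((K + 2) ^ (2 * D + 2)) (config (K + 1) .mark false x y)
      (config (K + 1) .done true 0 v) := by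
  have start : Encodes h₀ D (M.init (pairInput x y)) (stackConfig h₀ M.start ∅
      ((ListBlank.mk ((pairInput x y).map M.base)).cons (M.base .blank))) := by
    refine ⟨M.start, 0, ∅, _, congrArg _ (tapeOf_eq 0 _), rfl, Nat.pow_pos (K + 1).succ_pos, ?_⟩
    refine (stackValue_cons_lt_pow h₀ _
      (pushDigits_lt_pow (m := 0) (n := 0) _ Nat.one_pos)).trans_le ?_
    refine Nat.pow_le_pow_right (K + 1).succ_pos ?_
    rw [List.length_map, List.length_map]
    omega
  obtain ⟨γ, hγ, sim⟩ := Reaches.simulate (T := M.within D) (R := Encodes h₀ D)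
    (fun c hc _ γ h => exists_run_step hc h) (fun c hc γ h => h.mem_bounded hc)
    ⟨t, rfl, fun s _ => hspace s⟩ start
  obtain ⟨q, p, L, R, hc, rfl, hL, hR⟩ := hγ
  rw [hc] at hhalt htape
  obtain ⟨rfl, rfl⟩ := tapeAround_inj (htape.trans (tapeOf_eq p _))
  have hq : M.transition q (M.base .blank) = none := halted_facing_iff.1 hhalt
  have hp : |p| ≤ D := by simpa only [hc] using! hspace t
  rw [abs_le] at hp
  have input := run_input (code := code) h₀ (x := x) (y := y) (N := 2 * D + 2) (by omega)
  exact input.trans (sim.trans (run_output h₀ hq (le_pow_of_lt_pow hR (by omega))))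

end TuringMachine

/-! ### Counting steps -/

theorem exists_equiv_fin_apply_eq_zero {α : Type*} [Finite α] [Nontrivial α] (a : α) :
    ∃ K, ∃ e : α ≃ Fin (K + 2), e a = 0 := by
  obtain ⟨n, ⟨e⟩⟩ := Finite.exists_equiv_fin α
  have hn : 1 < n := by
    rw [← Nat.card_eq_of_equiv_fin e]
    exact Finite.one_lt_card
  obtain ⟨K, rfl⟩ := Nat.exists_eq_add_of_le' hn
  exact ⟨K, e.trans (Equiv.swap (e a) 0), Equiv.swap_apply_left _ _⟩

theorem two_pow_length_bits_le (n : ℕ) : 2 ^ n.bits.length ≤ 2 * n + 1 := by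
  rw [Nat.size_eq_bits_len]
  cases h : n.size with
  | zero => simp
  | succ s =>
    have : 2 ^ s ≤ n := Nat.lt_size.1 (by omega)
    omega

theorem exists_pow_length_bits_le_eval (b : ℕ) :
    ∃ p : Polynomial ℕ, ∀ n : ℕ, b ^ (n.bits.length + 1) ≤ p.eval n := by
  refine ⟨(4 * .X + 2) ^ b, fun n => ?_⟩
  calc b ^ (n.bits.length + 1)
      ≤ (2 ^ b) ^ (n.bits.length + 1) := Nat.pow_le_pow_left Nat.lt_two_pow_self.le _
    _ = (2 ^ (n.bits.length + 1)) ^ b := by rw [← pow_mul, ← pow_mul, mul_comm]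
    _ ≤ (4 * n + 2) ^ b := Nat.pow_le_pow_left (by
        rw [pow_succ]
        linarith [two_pow_length_bits_le n]) b
    _ = Polynomial.eval n ((4 * .X + 2) ^ b) := by simp

theorem length_bits_mono {m n : ℕ} (h : m ≤ n) : m.bits.length ≤ n.bits.length := by
  rw [Nat.size_eq_bits_len, Nat.size_eq_bits_len]
  exact Nat.size_le_size h

theorem length_pairInput_le (x y : ℕ) :
    (pairInput x y).length ≤ 2 * (max x y).bits.length + 1 := by
  have hx := length_bits_mono (le_max_left x y)
  have hy := length_bits_mono (le_max_right x y)
  rw [length_pairInput]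
  omega

instance (M : TuringMachine) : Nontrivial M.Symbol :=
  ⟨M.base .zero, M.base .one, by simp⟩

theorem ThreeCounterPolyTime.of_turingLinearSpace {f : ℕ → ℕ → ℕ} (hf : TuringLinearSpace f) :
    ThreeCounterPolyTime f := by
  obtain ⟨M, c, hM⟩ := hf
  have := M.finiteState
  have := M.finiteSymbol
  have := Fintype.ofFinite M.State
  obtain ⟨K, code, h₀⟩ := exists_equiv_fin_apply_eq_zero (M.base .blank)
  obtain ⟨n, ⟨e⟩⟩ := Finite.exists_equiv_fin
    (StackState M.State (Fin (K + 2)) × StackInstr.Phase (K + 1))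
  let P := FlowInstr.compile e (StackInstr.expand (M.stackProgram code)) (.mark, .start 0)
  obtain ⟨p, hp⟩ := exists_pow_length_bits_le_eval ((K + 2) ^ (4 * (c + 1) + 2))
  refine ⟨P, Polynomial.C (2 * n + 1) * (p + 1) ^ 3, fun x y => ?_⟩
  obtain ⟨⟨t, hhalt, htape⟩, hspace⟩ := hM x y
  have hrun := TuringMachine.run_stackProgram (D := (c + 1) * (pairInput x y).length) h₀
    (by nlinarith) hhalt htape (fun s => (hspace s).trans (by push_cast; nlinarith))
  obtain ⟨t, ht, hP, hval⟩ := FlowInstr.exists_le_halted_compile (e := e) rfl hrun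
  have hV : (K + 2) ^ (2 * ((c + 1) * (pairInput x y).length) + 2) ≤ p.eval (max x y) := by
    refine le_trans ?_ (hp (max x y))
    rw [← pow_mul]
    exact Nat.pow_le_pow_right (K + 1).succ_pos (by nlinarith [length_pairInput_le x y])
  refine ⟨t, ht.trans ?_, hP, congrFun hval 0⟩
  rw [Polynomial.eval_mul, Polynomial.eval_C, Polynomial.eval_pow, Polynomial.eval_add,
    Polynomial.eval_one]
  gcongr

theorem theorem1 :
    {f : ℕ → ℕ → ℕ | ThreeCounterPolyTime f} = {f : ℕ → ℕ → ℕ | TuringLinearSpace f} :=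
  Set.ext fun _ => ⟨.of_threeCounterPolyTime, .of_turingLinearSpace⟩
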